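/- Let $G$ be a finite plane graph (loops, multiple edges, isolated nodes and several components are allowed) with $N$ nodes, let $Q\ge 1$ be an integer and $K\in\mathbb C$; put $v=e^{K}-1$. The $Q$-state Potts partition function is $P_G=\sum_\sigma e^{K E(\sigma)}$, where $\sigma$ runs over the maps from the nodes of $G$ to $\{1,\dots,Q\}$ and $E(\sigma)$ is the number of edges whose two end-nodes receive the same value. Let $K(G)$ be the link diagram on the medial graph of $G$: one crossing on each edge, one arc in each corner, one crossingless circle around each isolated node, with crossings chosen so that smoothing along an edge (joining the regions of its end-nodes) is the $B$-smoothing. For a diagram $D$, a state $S$ is the set of crossings that receive a $B$-smoothing (all others receive an $A$-smoothing), $|S|$ is its number of elements and $\ell(S)$ its number of loops. For a square root $\sqrt Q\in\mathbb C$ of $Q$ (either one) put $$\{D\}=\sum_S (Q^{-1/2}v)^{|S|}\,(\sqrt Q)^{\ell(S)},\qquad [D](q,\rho)=\sum_S(-q\rho)^{|S|}(q+q^{-1})^{\ell(S)} .$$ An enhanced state $s$ is a state with a label $1$ or $X$ on each loop; $n_B(s)$ is its number of $B$-smoothings, $\lambda(s)$ the number of loops labelled $1$ minus the number labelled $X$,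 and $j(s)=n_B(s)+\lambda(s)$. Let $R$ be an integral domain, e.g. $\mathbb Z/2$ or $\mathbb Z$, and let $\mathcal C^{ij}$ be the free $R$-module on the enhanced states with $n_B=i$, $j(s)=j$. The Khovanov differential $\partial$ is the signed sum, over all $A$-sites, of the partial differentials that turn the site into a $B$-site and relabel by $1\cdot1=1$, $1\cdot X=X\cdot 1=X$, $X\cdot X=0$ when two loops merge, and by $\Delta(1)=1\otimes X+X\otimes 1$, $\Delta(X)=X\otimes X$ when a loop splits; the signs come from an ordering of the crossings. Let $H^{ij}$ be its homology, $\chi(H^{\bullet j})=\sum_i(-1)^i\operatorname{rank}H^{ij}$ and $\chi_\rho(\mathcal C^{\bullet j})=\sum_i(-\rho)^i\operatorname{rank}\mathcal C^{ij}$. For $D=K(G)$ the following hold. 1. $K(G)$ is a planar alternating diagram, $\partial$ maps $\mathcal C^{ij}$ into $\mathcal C^{i+1,j}$ and $\partial^2=0$. 2. $P_G=Q^{N/2}\{K(G)\}$, where $Q^{N/2}=(\sqrt Q)^N$, for either square root of $Q$. 3. For all $q\ne0$ and $\rho$ in $\mathbb C$: $[K(G)](q,\rho)=\sum_s(-\rho)^{n_B(s)}q^{j(s)}=\sum_j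 q^j\chi_\rho(\mathcal C^{\bullet j})$, the last sum having finitely many non-zero terms. 4. For every choice of $\sqrt Q$ there are $q\neq 0$ and $\rho$ in $\mathbb C$ with $$-q\rho=Q^{-1/2}v,\qquad q+q^{-1}=\sqrt Q .\qquad(*)$$ Whenever $(*)$ holds, $\{K(G)\}=[K(G)](q,\rho)$ and $P_G=Q^{N/2}\sum_jq^j\chi_\rho(\mathcal C^{\bullet j})$; moreover $q=\frac{\sqrt Q+w}{2}$ and $q^{-1}=\frac{\sqrt Q-w}2$ for some $w$ with $w^2=Q-4$, and $\rho=v\,\frac{-1+u}{2}$ for some $u$ with $u^2=1-4/Q$. 5. $\chi_1(\mathcal C^{\bullet j})=\chi(H^{\bullet j})$ for all $j$. If $G$ has at least one edge then, for $\rho\in\mathbb C$, the coefficients $\chi_\rho(\mathcal C^{\bullet j})$ equal the Euler characteristics $\chi(H^{\bullet j})$ for all $j$ if and only if $\rho=1$. If $(*)$ holds with $\rho=1$, then $P_G=Q^{N/2}\sum_jq^j\chi(H^{\bullet j})$. 6. $(*)$ can be satisfied with $\rho=1$ (for some choice of $\sqrt Q$ and $q$) if and only if $e^K=\frac{2-Q-rw}{2}$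 for some $r,w$ with $r^2=Q$, $w^2=Q-4$. For $Q=2$ this is the case if and only if $e^K=\pm i$; for $Q=3$ if and only if $e^K=\frac{-1\pm\sqrt3\,i}{2}$; for $Q=4$ if and only if $e^K=-1$; and for $Q>4$ it implies that $e^K$ is real and negative. In all cases of $\rho=1$, $K$ is not real, and if $K=J/(kT)$ with $J=\pm1$ and $k>0$ real then the temperature $T$ is not real. 7. (Criticality.) $(*)$ can be satisfied with $\rho=1$ and $-\rho q=1$ (for some choice of $\sqrt Q$ and $q$) if and only if $Q=4$ and $e^K=-1$; in that case necessarily $\sqrt Q=-2$, $q=-1$ and $K=(2n+1)i\pi$ for some integer $n$. -/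

import Mathlib

noncomputable section

/-! ### Link diagrams, smoothings, loops, enhanced states -/

/-- A link diagram with set of crossings `X` and set of crossingless circles `C`.
The four half-arcs at a crossing `c` are `(c,0), (c,1), (c,2), (c,3)` in counterclockwise order;
the strand through `(c,0)` and `(c,2)` passes under the strand through `(c,1)` and `(c,3)`.
The map `arc` sends a half-arc to the half-arc at the other end of the same arc. -/
structure LinkDiagram (X C : Type*) where
  arc : X × Fin 4 → X × Fin 4
  arc_arc : ∀ h, arc (arc h) = h
  arc_ne : ∀ h, arc h ≠ h

/-- The labels `1` and `X` of loops in an enhanced state. -/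
inductive LoopLabel
  | one
  | X
  deriving DecidableEq

namespace LoopLabel

instance : Fintype LoopLabel := ⟨{one, X}, fun a => by cases a <;> decide⟩

/-- Multiplication of the basis `1, X` of `k[X]/(X²)`; `none` stands for `X * X = 0`. -/
def mul : LoopLabel → LoopLabel → Option LoopLabel
  | one, one => some one
  | one, X => some X
  | X, one => some X
  | X, X => none

/-- The basis tensors in `Δ(1) = 1 ⊗ X + X ⊗ 1` and in `Δ(X) = X ⊗ X`. -/
def comul : LoopLabel → Set (LoopLabel × LoopLabel)
  | one => {(one, X), (X, one)}
  | X => {(X, X)}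

end LoopLabel

namespace LinkDiagram

variable {X C : Type*} (D : LinkDiagram X C)

/-- The arcs join over-passing ends to under-passing ends. -/
def IsAlternating : Prop :=
  ∀ h, ((D.arc h).2 = 1 ∨ (D.arc h).2 = 3) ↔ ¬ (h.2 = 1 ∨ h.2 = 3)

/-- The regions bounded by the arcs of the projection (one for each boundary walk). -/
def Region : Type _ :=
  Quotient (Relation.EqvGen.setoid fun a b : X × Fin 4 => b = ((D.arc a).1, (D.arc a).2 + 1))

/-- The connected components of the projection that contain a crossing. -/
def ProjectionComponent : Type _ :=
  Quotient (Relation.EqvGen.setoid fun a b : X × Fin 4 => b = D.arc a ∨ b.1 = a.1)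

/-- The projection is a plane `4`-valent graph: Euler's formula `V - E + F = 2c`, with `V` crossings
and `E = 2 V` arcs. (Euler's formula in this total form forces genus `0` for every component.) -/
def IsPlanar : Prop :=
  Nat.card X + Nat.card D.Region = 2 * Nat.card X + 2 * Nat.card D.ProjectionComponent

/-- A state is the set `S` of crossings that carry a `B`-smoothing. The `A`-smoothing at a crossing
joins `0` to `1` and `2` to `3` (it opens the two regions swept by the over-strand when it is turned
counterclockwise); the `B`-smoothing joins `1` to `2` and `3` to `0`. -/
def smoothing [DecidableEq X] (S : Finset X) (h : X × Fin 4) : X × Fin 4 :=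
  (h.1, (if h.1 ∈ S then 3 else 1) - h.2)

variable [DecidableEq X]

/-- Two half-arcs lie on the same loop of the state `S`. -/
def loopSetoid (S : Finset X) : Setoid (X × Fin 4) :=
  Relation.EqvGen.setoid fun a b => b = D.arc a ∨ b = smoothing S a

/-- The loops of the state `S`, the crossingless circles included. -/
def Loop (S : Finset X) : Type _ := Quotient (D.loopSetoid S) ⊕ C

/-- The loop of the state `S` through a half-arc. -/
def loopAt (S : Finset X) (h : X × Fin 4) : D.Loop S := Sum.inl (Quotient.mk (D.loopSetoid S) h)

/-- The loop of the state `S` given by a crossingless circle. -/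
def loopCircle (S : Finset X) (c : C) : D.Loop S := Sum.inr c

instance [Finite X] [Finite C] (S : Finset X) : Finite (D.Loop S) :=
  inferInstanceAs (Finite (Quotient (D.loopSetoid S) ⊕ C))

/-- The state sum of the bracket in which a crossing equals its `A`-smoothing plus `b` times its
`B`-smoothing, and in which a loop has the value `δ`. -/
def bracket [Fintype X] (b δ : ℂ) : ℂ :=
  ∑ S : Finset X, b ^ S.card * δ ^ Nat.card (D.Loop S)

/-- The `ρ`-bracket: a crossing is `A`-smoothing minus `qρ` times `B`-smoothing, a loop is
`q + q⁻¹`. -/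
def rhoBracket [Fintype X] (q ρ : ℂ) : ℂ := D.bracket (-(q * ρ)) (q + q⁻¹)

/-- Enhanced states: a state together with a label on each of its loops. -/
def EnhancedState : Type _ := Σ S : Finset X, (D.Loop S → LoopLabel)

instance [Finite X] [Finite C] : Finite D.EnhancedState :=
  inferInstanceAs (Finite (Σ S : Finset X, (D.Loop S → LoopLabel)))

instance [Finite X] [Finite C] : Fintype D.EnhancedState := Fintype.ofFinite _

variable {D}

/-- `n_B(s)`, the number of `B`-smoothings. -/
def EnhancedState.nB (s : D.EnhancedState) : ℕ := s.1.card

/-- `λ(s)`, the number of loops labelled `1` minus the number of loops labelled `X`. -/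
def EnhancedState.lam (s : D.EnhancedState) : ℤ :=
  (Nat.card {l // s.2 l = LoopLabel.one} : ℤ) - (Nat.card {l // s.2 l = LoopLabel.X} : ℤ)

/-- `j(s) = n_B(s) + λ(s)`. -/
def EnhancedState.jdeg (s : D.EnhancedState) : ℤ := (s.nB : ℤ) + s.lam

/-- The label of the loop through a half-arc. -/
def EnhancedState.labelAt (s : D.EnhancedState) (h : X × Fin 4) : LoopLabel :=
  s.2 (D.loopAt s.1 h)

variable (D)

/-- The enhanced state `s'` occurs in the partial differential `∂_τ(s)`: the site `τ` is of type `A`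
in `s`, it is resmoothed to type `B`, loops that do not pass through `τ` keep their labels, and at
`τ` either two loops merge and the labels are multiplied, or one loop splits in two and its label is
comultiplied. (The two local strands at `τ` are those through `(τ,0)` and `(τ,2)`, for either
smoothing.) -/
def IsPartialTerm (τ : X) (s s' : D.EnhancedState) : Prop :=
  τ ∉ s.1 ∧ s'.1 = insert τ s.1 ∧
  (∀ h, (∀ k, D.loopAt s.1 h ≠ D.loopAt s.1 (τ, k)) → s'.labelAt h = s.labelAt h) ∧
  (∀ c : C, s'.2 (D.loopCircle s'.1 c) = s.2 (D.loopCircle s.1 c)) ∧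
  ((D.loopAt s.1 (τ, 0) ≠ D.loopAt s.1 (τ, 2) ∧ D.loopAt s'.1 (τ, 0) = D.loopAt s'.1 (τ, 2) ∧
      LoopLabel.mul (s.labelAt (τ, 0)) (s.labelAt (τ, 2)) = some (s'.labelAt (τ, 0))) ∨
    (D.loopAt s.1 (τ, 0) = D.loopAt s.1 (τ, 2) ∧ D.loopAt s'.1 (τ, 0) ≠ D.loopAt s'.1 (τ, 2) ∧
      (s'.labelAt (τ, 0), s'.labelAt (τ, 2)) ∈ LoopLabel.comul (s.labelAt (τ, 0))))

end LinkDiagram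

/-! ### The Khovanov complex over a commutative ring -/

namespace LinkDiagram

variable {X C : Type*} [Fintype X] [LinearOrder X] [Finite C]
variable (R : Type*) [CommRing R] (D : LinkDiagram X C)

/-- The chain module: the free module on the (finitely many) enhanced states; a function `f` stands
for the chain `∑_s f(s) s`. -/
abbrev Chain : Type _ := D.EnhancedState → R

open Classical in
/-- The coefficient of `s'` in `∂(s) = ∑_τ ± ∂_τ(s)`; the sign is that of `dx_τ ∧ dx_S` where `S` is
the (ordered) set of `B`-sites of `s`. Over `ℤ/2` the signs are immaterial. -/
def incidence (s s' : D.EnhancedState) : R :=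
  ∑ τ : X, if D.IsPartialTerm τ s s' then (-1 : R) ^ (s.1.filter fun σ => σ < τ).card else 0

/-- The Khovanov differential. -/
def differential : D.Chain R →ₗ[R] D.Chain R where
  toFun f s' := ∑ s : D.EnhancedState, f s * D.incidence R s s'
  map_add' f g := by
    funext s'
    simp [add_mul, Finset.sum_add_distrib]
  map_smul' a f := by
    funext s'
    simp [mul_assoc, Finset.mul_sum]

/-- `C^{ij}`: the chains that involve only enhanced states with `n_B(s) = i` and `j(s) = j`. -/
def chainGroup (i j : ℤ) : Submodule R (D.Chain R) where
  carrier := {f | ∀ s : D.EnhancedState, ¬ ((s.nB : ℤ) = i ∧ s.jdeg = j) → f s = 0}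
  add_mem' hf hg s hs := by simp [hf s hs, hg s hs]
  zero_mem' _ _ := rfl
  smul_mem' a f hf s hs := by simp [hf s hs]

/-- The cycles in `C^{ij}`. -/
def cycles (i j : ℤ) : Submodule R (D.Chain R) :=
  D.chainGroup R i j ⊓ LinearMap.ker (D.differential R)

/-- The image of `C^{i-1,j}`. -/
def boundaries (i j : ℤ) : Submodule R (D.Chain R) :=
  (D.chainGroup R (i - 1) j).map (D.differential R)

/-- The Khovanov homology `H^{ij}`: cycles modulo boundaries. -/
abbrev Homology (i j : ℤ) : Type _ :=
  D.cycles R i j ⧸ (D.boundaries R i j).submoduleOf (D.cycles R i j)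

/-- The generalized Euler characteristic `χ_ρ(C^{•j}) = ∑_i (-ρ)^i dim C^{ij}`; note that
`C^{ij} = 0` unless `0 ≤ i ≤ #crossings`. -/
def chiRho (ρ : ℂ) (j : ℤ) : ℂ :=
  ∑ i ∈ Finset.range (Fintype.card X + 1),
    (-ρ) ^ i * (Module.finrank R (D.chainGroup R (i : ℤ) j) : ℂ)

/-- The Euler characteristic `χ(H^{•j}) = ∑_i (-1)^i rank H^{ij}` of Khovanov homology. -/
def chiHomology (j : ℤ) : ℤ :=
  ∑ i ∈ Finset.range (Fintype.card X + 1),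
    (-1 : ℤ) ^ i * (Module.finrank R (D.Homology R (i : ℤ) j) : ℤ)

end LinkDiagram

/-! ### Plane graphs, their link diagrams and the Potts model -/

/-- Reversal of darts. A dart is an edge with one of its two ends. -/
def dartFlip (E : Type*) : Equiv.Perm (E × Bool) :=
  Equiv.prodCongr (Equiv.refl E) Equiv.boolNot

/-- A plane graph (loops, multiple edges, isolated nodes and several components are allowed) as a
combinatorial map: `vert d` is the node from which the dart `d` issues, `rot d` is the next dart
counterclockwise around that node, and every component has genus `0`, which is Euler's formula
`V - E + F = 2c` for the part of the graph without its isolated nodes. -/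
structure PlaneGraph (V E : Type*) where
  vert : E × Bool → V
  rot : Equiv.Perm (E × Bool)
  sameCycle_iff : ∀ d d', rot.SameCycle d d' ↔ vert d = vert d'
  euler : Nat.card (Quotient (Equiv.Perm.SameCycle.setoid rot)) +
      Nat.card (Quotient (Equiv.Perm.SameCycle.setoid (rot * dartFlip E))) =
    Nat.card E + 2 * Nat.card (Quotient (Relation.EqvGen.setoid
      fun d d' : E × Bool => d' = rot d ∨ d' = dartFlip E d))

namespace PlaneGraph

variable {V E : Type*} (G : PlaneGraph V E)

/-- The nodes without edges. -/
abbrev IsolatedNode : Type _ := {x : V // ∀ d, G.vert d ≠ x}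

/-- The half-arc of the medial diagram on the left side of a dart (seen from its node). -/
def leftSide (d : E × Bool) : E × Fin 4 := (d.1, if d.2 then 2 else 0)

/-- The half-arc of the medial diagram on the right side of a dart (seen from its node). -/
def rightSide (d : E × Bool) : E × Fin 4 := (d.1, if d.2 then 3 else 1)

/-- The arcs of the medial diagram: one in each corner between a dart `d` and the next dart `rot d`,
from the left side of `d` to the right side of `rot d`. -/
def medialArc : E × Fin 4 → E × Fin 4
  | (e, 0) => rightSide (G.rot (e, false))
  | (e, 1) => leftSide (G.rot.symm (e, false))
  | (e, 2) => rightSide (G.rot (e, true))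
  | (e, 3) => leftSide (G.rot.symm (e, true))

theorem medialArc_leftSide (d : E × Bool) : G.medialArc (leftSide d) = rightSide (G.rot d) := by
  obtain ⟨e, b⟩ := d
  cases b <;> rfl

theorem medialArc_rightSide (d : E × Bool) :
    G.medialArc (rightSide d) = leftSide (G.rot.symm d) := by
  obtain ⟨e, b⟩ := d
  cases b <;> rfl

theorem exists_side (h : E × Fin 4) : (∃ d, h = leftSide d) ∨ ∃ d, h = rightSide d := by
  obtain ⟨e, k⟩ := h
  fin_cases k
  · exact Or.inl ⟨(e, false), rfl⟩
  · exact Or.inr ⟨(e, false), rfl⟩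
  · exact Or.inl ⟨(e, true), rfl⟩
  · exact Or.inr ⟨(e, true), rfl⟩

theorem leftSide_ne_rightSide (d d' : E × Bool) : leftSide d ≠ rightSide d' := by
  obtain ⟨e, b⟩ := d
  obtain ⟨e', b'⟩ := d'
  cases b <;> cases b' <;> simp [leftSide, rightSide]

/-- The link diagram `K(G)` on the medial graph: a crossing on each edge, with the crossing type for
which smoothing along the edge (which joins the regions of the two end-nodes) is the `B`-smoothing,
and a crossingless circle around each isolated node. -/
def linkDiagram : LinkDiagram E G.IsolatedNode where
  arc := G.medialArc
  arc_arc h := by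
    rcases exists_side h with ⟨d, rfl⟩ | ⟨d, rfl⟩
    · simp [medialArc_leftSide, medialArc_rightSide]
    · simp [medialArc_leftSide, medialArc_rightSide]
  arc_ne h := by
    rcases exists_side h with ⟨d, rfl⟩ | ⟨d, rfl⟩
    · rw [medialArc_leftSide]
      exact (leftSide_ne_rightSide _ _).symm
    · rw [medialArc_rightSide]
      exact leftSide_ne_rightSide _ _

/-- The energy of a spin state: the number of edges whose end-nodes receive the same spin. -/
def energy [Fintype E] {Q : ℕ} (σ : V → Fin Q) : ℕ :=
  (Finset.univ.filter fun e : E => σ (G.vert (e, false)) = σ (G.vert (e, true))).card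

/-- The partition function `P_G = ∑_σ e^{K E(σ)}` of the `Q`-state Potts model. -/
def potts [Fintype V] [DecidableEq V] [Fintype E] (Q : ℕ) (K : ℂ) : ℂ :=
  ∑ σ : V → Fin Q, Complex.exp (K * (G.energy σ : ℂ))

end PlaneGraph

/-- `q, ρ` are the variables of the `ρ`-bracket that correspond to the `Q`-state Potts model with
parameter `K`, where `r` is the chosen (complex) square root of `Q`:
`-qρ = Q^{-1/2} v` and `q + q⁻¹ = Q^{1/2}`, with `v = e^K - 1`. -/
structure IsPottsParam (Q : ℕ) (K r q ρ : ℂ) : Prop where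
  sq_root : r ^ 2 = (Q : ℂ)
  q_ne : q ≠ 0
  loop_value : q + q⁻¹ = r
  site_value : -(q * ρ) = r⁻¹ * (Complex.exp K - 1)

end

/-!
The Potts partition function expands, through `e^{Kδ} = 1 + vδ` on each edge, over the spanning
subgraphs `S` of `G`, with weight `v^|S| Q^{c(S)}`. The loops of the state `S` of `K(G)` are the
boundary curves of the ribbon graph with edge set `S`; as `G` is plane, Euler's formula says that
there are `2 c(S) + |S| - N` of them, which turns the weight into the one of the bracket.

Adding an edge to `S` multiplies the permutation of darts whose cycles are the loops by a
transposition (up to the symmetry that exchanges the two sides of a dart), so a loop is split or two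
loops are merged. Planarity thereby excludes the single-cycle smoothings for which the partial
differentials would not be defined, and the bigrading and `∂² = 0` become statements about
merging and splitting labelled points of a quotient.

The labels `1` and `X` contribute `q` and `q⁻¹` to the `ρ`-bracket, whose coefficients at `ρ = 1`
are Euler characteristics because ranks of chain groups and of homology differ by a telescoping sum.
Conversely, the `ρ`-bracket at `q = e^{± iπ/3}`, where each loop has value `1`, leaves only `ρ = 0`
and `ρ = 1`, and comparing the Potts model with `Q = 5` at two temperatures excludes `ρ = 0`.
-/

/-! ### Identifying two points of a quotient -/

section IdentifyPair

variable {α : Type*} {s t : Setoid α} {a b : α}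

open Classical in
/-- The setoid obtained from `s` by identifying the classes of `a` and `b`. It is encoded as the
kernel of the map that sends every point to its class, except that the class of `b` is moved onto
the class of `a`. -/
noncomputable def identifyPair (s : Setoid α) (a b : α) : Setoid α :=
  Setoid.ker fun x => Function.update id (Quotient.mk s b) (Quotient.mk s a) (Quotient.mk s x)

theorem identifyPair_iff {x y : α} :
    identifyPair s a b x y ↔ s x y ∨ (s x a ∧ s b y) ∨ (s x b ∧ s a y) := by
  rw [identifyPair, Setoid.ker_def]
  simp only [Function.update_apply, id, ← Quotient.eq]
  grind

theorem le_identifyPair : s ≤ identifyPair s a b := fun _ _ h => identifyPair_iff.2 (.inl h)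

theorem identifyPair_rel : identifyPair s a b a b :=
  identifyPair_iff.2 (.inr (.inl ⟨s.refl' a, s.refl' b⟩))

theorem identifyPair_le_iff : identifyPair s a b ≤ t ↔ s ≤ t ∧ t a b := by
  refine ⟨fun h => ⟨le_identifyPair.trans h, h identifyPair_rel⟩, fun ⟨hs, hab⟩ x y h => ?_⟩
  rcases identifyPair_iff.1 h with h | ⟨hx, hy⟩ | ⟨hx, hy⟩
  · exact hs h
  · exact t.trans' (hs hx) (t.trans' hab (hs hy))
  · exact t.trans' (hs hx) (t.trans' (t.symm' hab) (hs hy))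

theorem identifyPair_eq_self (h : s a b) : identifyPair s a b = s :=
  le_antisymm (identifyPair_le_iff.2 ⟨le_rfl, h⟩) le_identifyPair

theorem card_quotient_identifyPair [Finite α] (h : ¬ s a b) :
    Nat.card (Quotient (identifyPair s a b)) + 1 = Nat.card (Quotient s) := by
  classical
  have range_eq : (Set.range fun x =>
      Function.update id (Quotient.mk s b) (Quotient.mk s a) (Quotient.mk s x)) =
        {Quotient.mk s b}ᶜ := by
    have hne : Quotient.mk s a ≠ Quotient.mk s b := fun k => h (Quotient.exact k)
    ext c
    constructor
    · rintro ⟨x, rfl⟩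
      by_cases hx : Quotient.mk s x = Quotient.mk s b <;> simp [hx, hne]
    · intro hc
      induction c using Quotient.inductionOn with
      | h x => exact ⟨x, Function.update_of_ne hc _ _⟩
  rw [identifyPair, Nat.card_congr (Setoid.quotientKerEquivRange _), range_eq]
  have := Set.ncard_add_ncard_compl {Quotient.mk s b}
  rw [Set.ncard_singleton, ← Nat.card_coe_set_eq] at this
  omega

end IdentifyPair

/-! ### Cycles of a permutation times a transposition -/

section SameCycle

open Equiv Equiv.Perm

variable {α : Type*} {f : Perm α}

theorem sameCycle_setoid_le {t : Setoid α} (h : ∀ x, t x (f x)) : SameCycle.setoid f ≤ t := by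
  rintro x _ ⟨n, rfl⟩
  induction n using Int.induction_on with
  | zero => exact t.refl' x
  | succ n ih =>
    rw [add_comm, zpow_one_add, Perm.mul_apply]
    exact t.trans' ih (h _)
  | pred n ih =>
    have step := h ((f ^ (-(n : ℤ) - 1)) x)
    rw [← Perm.mul_apply, ← zpow_one_add, add_sub_cancel] at step
    exact t.trans' ih (t.symm' step)

variable [Finite α]

theorem mem_of_sameCycle_of_mapsTo {A : Set α} (hA : Set.MapsTo f A A) {x y : α}
    (h : f.SameCycle x y) (hx : x ∈ A) : y ∈ A := by
  obtain ⟨n, rfl⟩ := h.exists_nat_pow_eq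
  exact hA.perm_pow n hx

variable [DecidableEq α] {a b : α}

theorem sameCycle_mul_swap_of_not_sameCycle (h : ¬ f.SameCycle a b) :
    (f * swap a b).SameCycle a b := by
  have apply_a : (f * swap a b) a = f b := by simp
  have fb_mem : f.SameCycle b (f b) ∧ (f * swap a b).SameCycle a (f b) :=
    ⟨sameCycle_apply_right.2 .rfl, apply_a ▸ sameCycle_apply_right.2 .rfl⟩
  refine (mem_of_sameCycle_of_mapsTo
    (A := {x | f.SameCycle b x ∧ (f * swap a b).SameCycle a x}) ?_ fb_mem.1.symm fb_mem).2
  rintro x ⟨hbx, hax⟩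
  by_cases hxb : x = b
  · exact hxb ▸ fb_mem
  · have hxa : x ≠ a := fun hxa => h (hxa ▸ hbx.symm)
    have apply_x : (f * swap a b) x = f x := by simp [swap_apply_of_ne_of_ne hxa hxb]
    exact ⟨sameCycle_apply_right.2 hbx, apply_x ▸ sameCycle_apply_right.2 hax⟩

theorem not_sameCycle_mul_swap_of_sameCycle (hab : a ≠ b) (h : f.SameCycle a b) :
    ¬ (f * swap a b).SameCycle a b := by
  classical
  have reaches := h.exists_nat_pow_eq
  set n := Nat.find reaches
  have apply_n : (f ^ n) a = b := Nat.find_spec reaches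
  have first : ∀ m < n, (f ^ m) a ≠ b := fun m => Nat.find_min reaches
  have n_pos : 0 < n := Nat.pos_of_ne_zero fun h0 => hab (by simpa [h0] using apply_n)
  have a_notMem : ∀ i, 0 < i → i ≤ n → (f ^ i) a ≠ a := fun i hi hin hia =>
    first (n - i) (by omega) <| by
      conv_lhs => rw [← hia, ← Perm.mul_apply, ← pow_add, Nat.sub_add_cancel hin, apply_n]
  -- the part of the cycle of `f` from `f a` to `b` closes up to a cycle of `f * swap a b`
  have segment : Set.MapsTo (f * swap a b) {x | ∃ i, 0 < i ∧ i ≤ n ∧ (f ^ i) a = x}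
      {x | ∃ i, 0 < i ∧ i ≤ n ∧ (f ^ i) a = x} := by
    rintro _ ⟨i, hi, hin, rfl⟩
    rcases hin.lt_or_eq with hlt | rfl
    · refine ⟨i + 1, by omega, hlt, ?_⟩
      rw [Perm.mul_apply, swap_apply_of_ne_of_ne (a_notMem i hi hin) (first i hlt), pow_succ',
        Perm.mul_apply]
    · exact ⟨1, one_pos, n_pos, by rw [apply_n, Perm.mul_apply, swap_apply_right, pow_one]⟩
  intro hba
  obtain ⟨i, hi, hin, hia⟩ :=
    mem_of_sameCycle_of_mapsTo segment hba.symm ⟨n, n_pos, le_rfl, apply_n⟩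
  exact a_notMem i hi hin hia

theorem sameCycle_mul_swap_iff (hab : a ≠ b) :
    (f * swap a b).SameCycle a b ↔ ¬ f.SameCycle a b :=
  ⟨fun h h' => not_sameCycle_mul_swap_of_sameCycle hab h' h, sameCycle_mul_swap_of_not_sameCycle⟩

end SameCycle
/-! ### Loops of adjacent states -/

namespace LinkDiagram

section LoopSetoid

variable {X C : Type*} [DecidableEq X] (D : LinkDiagram X C) {S T : Finset X} {τ : X}

theorem loopSetoid_arc (S : Finset X) (h : X × Fin 4) : D.loopSetoid S h (D.arc h) :=
  Relation.EqvGen.rel _ _ (.inl rfl)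

theorem loopSetoid_smoothing (S : Finset X) (h : X × Fin 4) :
    D.loopSetoid S h (smoothing S h) :=
  Relation.EqvGen.rel _ _ (.inr rfl)

theorem loopSetoid_le {t : Setoid (X × Fin 4)} (harc : ∀ h, t h (D.arc h))
    (hsmoothing : ∀ h, t h (smoothing S h)) : D.loopSetoid S ≤ t := by
  refine Setoid.eqvGen_le ?_
  rintro x y (rfl | rfl)
  exacts [harc x, hsmoothing x]

theorem loopSetoid_zero_one (h : τ ∉ S) : D.loopSetoid S (τ, 0) (τ, 1) := by
  simpa [smoothing, h] using D.loopSetoid_smoothing S (τ, 0)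

theorem loopSetoid_two_three (h : τ ∉ S) : D.loopSetoid S (τ, 2) (τ, 3) := by
  simpa [smoothing, h, show (1 : Fin 4) - 2 = 3 from rfl] using D.loopSetoid_smoothing S (τ, 2)

theorem loopSetoid_zero_three (h : τ ∈ S) : D.loopSetoid S (τ, 0) (τ, 3) := by
  simpa [smoothing, h] using D.loopSetoid_smoothing S (τ, 0)

theorem loopSetoid_two_one (h : τ ∈ S) : D.loopSetoid S (τ, 2) (τ, 1) := by
  simpa [smoothing, h, show (3 : Fin 4) - 2 = 1 from rfl] using D.loopSetoid_smoothing S (τ, 2)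

theorem loopSetoid_zero_or_two (S : Finset X) (τ : X) (k : Fin 4) :
    D.loopSetoid S (τ, 0) (τ, k) ∨ D.loopSetoid S (τ, 2) (τ, k) := by
  by_cases h : τ ∈ S
  · fin_cases k
    exacts [.inl (Setoid.refl' _ _), .inr (D.loopSetoid_two_one h),
      .inr (Setoid.refl' _ _), .inl (D.loopSetoid_zero_three h)]
  · fin_cases k
    exacts [.inl (Setoid.refl' _ _), .inl (D.loopSetoid_zero_one h),
      .inr (Setoid.refl' _ _), .inr (D.loopSetoid_two_three h)]

/-- The two strands of the smoothed crossing `τ` belong to the same loop of the state `S`. Whatever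
the smoothing, one of the strands contains the half-arc `(τ, 0)` and the other one `(τ, 2)`. -/
def SelfTouching (S : Finset X) (τ : X) : Prop :=
  D.loopSetoid S (τ, 0) (τ, 2)

theorem loopSetoid_le_identifyPair (hST : ∀ σ ≠ τ, σ ∈ S ↔ σ ∈ T) :
    D.loopSetoid S ≤ identifyPair (D.loopSetoid T) (τ, 0) (τ, 2) := by
  set t := identifyPair (D.loopSetoid T) (τ, 0) (τ, 2)
  refine D.loopSetoid_le (fun h => le_identifyPair (D.loopSetoid_arc T h)) fun ⟨σ, k⟩ => ?_
  rcases eq_or_ne σ τ with rfl | hσ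
  · have all_rel (k) : t (σ, 0) (σ, k) := (D.loopSetoid_zero_or_two T σ k).elim
      (fun h => le_identifyPair h) fun h => t.trans' identifyPair_rel (le_identifyPair h)
    exact t.trans' (t.symm' (all_rel k)) (all_rel _)
  · have smoothing_eq : smoothing S (σ, k) = smoothing T (σ, k) := by simp [smoothing, hST σ hσ]
    rw [smoothing_eq]
    exact le_identifyPair (D.loopSetoid_smoothing T _)

theorem identifyPair_loopSetoid_insert (S : Finset X) (τ : X) :
    identifyPair (D.loopSetoid (insert τ S)) (τ, 0) (τ, 2) =
      identifyPair (D.loopSetoid S) (τ, 0) (τ, 2) :=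
  le_antisymm
    (identifyPair_le_iff.2
      ⟨D.loopSetoid_le_identifyPair fun σ hσ => by simp [hσ], identifyPair_rel⟩)
    (identifyPair_le_iff.2
      ⟨D.loopSetoid_le_identifyPair fun σ hσ => by simp [hσ], identifyPair_rel⟩)

/-- Resmoothing a single site always merges two loops or splits a loop in two; the third
possibility, a loop that is reconnected to a single loop, occurs for virtual diagrams only. -/
def MergesOrSplits : Prop :=
  ∀ (S : Finset X) (τ : X), τ ∉ S → (D.SelfTouching (insert τ S) τ ↔ ¬ D.SelfTouching S τ)

variable {D}

theorem not_selfTouching_insert (hD : D.MergesOrSplits) (hτ : τ ∉ S) (h : D.SelfTouching S τ) :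
    ¬ D.SelfTouching (insert τ S) τ :=
  fun h' => (hD S τ hτ).1 h' h

theorem loopSetoid_insert_of_merge (hD : D.MergesOrSplits) (hτ : τ ∉ S)
    (h : ¬ D.SelfTouching S τ) :
    D.loopSetoid (insert τ S) = identifyPair (D.loopSetoid S) (τ, 0) (τ, 2) := by
  rw [← identifyPair_loopSetoid_insert, identifyPair_eq_self ((hD S τ hτ).2 h)]

theorem loopSetoid_of_selfTouching (h : D.SelfTouching S τ) :
    D.loopSetoid S = identifyPair (D.loopSetoid (insert τ S)) (τ, 0) (τ, 2) := by
  rw [identifyPair_loopSetoid_insert, identifyPair_eq_self h]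

theorem card_loop [Finite X] [Finite C] (D : LinkDiagram X C) (S : Finset X) :
    Nat.card (D.Loop S) = Nat.card (Quotient (D.loopSetoid S)) + Nat.card C :=
  Nat.card_sum

theorem card_loop_insert_of_merge [Finite X] [Finite C] (hD : D.MergesOrSplits) (hτ : τ ∉ S)
    (h : ¬ D.SelfTouching S τ) :
    Nat.card (D.Loop (insert τ S)) + 1 = Nat.card (D.Loop S) := by
  rw [card_loop, card_loop, loopSetoid_insert_of_merge hD hτ h, ← card_quotient_identifyPair h]
  omega

theorem card_loop_insert_of_split [Finite X] [Finite C] (hD : D.MergesOrSplits) (hτ : τ ∉ S)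
    (h : D.SelfTouching S τ) :
    Nat.card (D.Loop (insert τ S)) = Nat.card (D.Loop S) + 1 := by
  rw [card_loop, card_loop, loopSetoid_of_selfTouching h,
    ← card_quotient_identifyPair (not_selfTouching_insert hD hτ h)]
  omega

end LoopSetoid

end LinkDiagram

/-! ### Counting classes along maps -/

section CardQuotient

variable {α β γ : Type*} {s : Setoid α} {s' : Setoid β} {t : Setoid γ}

theorem card_quotient_eq_of_forall_exists (f : α → γ) (hf : ∀ x y, s x y ↔ t (f x) (f y))
    (hsurj : ∀ z, ∃ x, t (f x) z) : Nat.card (Quotient s) = Nat.card (Quotient t) := by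
  refine Nat.card_eq_of_bijective (Quotient.map f fun x y => (hf x y).1)
    ⟨fun c d h => ?_, fun c => ?_⟩
  · induction c, d using Quotient.inductionOn₂ with
    | h x y => exact Quotient.sound ((hf x y).2 (Quotient.exact h))
  · induction c using Quotient.inductionOn with
    | h z =>
      obtain ⟨x, hx⟩ := hsurj z
      exact ⟨Quotient.mk s x, Quotient.sound hx⟩

theorem card_quotient_eq_add [Finite α] [Finite β] (f : α → γ) (g : β → γ)
    (hf : ∀ x y, s x y ↔ t (f x) (f y)) (hg : ∀ x y, s' x y ↔ t (g x) (g y))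
    (hdisj : ∀ x y, ¬ t (f x) (g y)) (hsurj : ∀ z, (∃ x, t (f x) z) ∨ ∃ y, t (g y) z) :
    Nat.card (Quotient t) = Nat.card (Quotient s) + Nat.card (Quotient s') := by
  rw [← Nat.card_sum]
  refine (Nat.card_eq_of_bijective (Sum.elim (Quotient.map f fun x y => (hf x y).1)
    (Quotient.map g fun x y => (hg x y).1)) ⟨?_, fun c => ?_⟩).symm
  · rintro (c | c) (d | d) h <;> induction c, d using Quotient.inductionOn₂ with | h x y
    · exact congrArg Sum.inl (Quotient.sound ((hf x y).2 (Quotient.exact h)))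
    · exact absurd (Quotient.exact h) (hdisj x y)
    · exact absurd (Quotient.exact h.symm) (hdisj y x)
    · exact congrArg Sum.inr (Quotient.sound ((hg x y).2 (Quotient.exact h)))
  · induction c using Quotient.inductionOn with
    | h z =>
      rcases hsurj z with ⟨x, hx⟩ | ⟨y, hy⟩
      exacts [⟨.inl (Quotient.mk s x), Quotient.sound hx⟩,
        ⟨.inr (Quotient.mk s' y), Quotient.sound hy⟩]

end CardQuotient

/-! ### The loops of `K(G)` as cycles of darts -/

namespace PlaneGraph

variable {V E : Type*} (G : PlaneGraph V E)

/-- The dart at whose side a half-arc of the medial diagram lies. -/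
def sideDart : E × Fin 4 → E × Bool
  | (e, 0) | (e, 1) => (e, false)
  | (e, 2) | (e, 3) => (e, true)

@[simp]
theorem sideDart_leftSide (d : E × Bool) : sideDart (leftSide d) = d := by
  obtain ⟨e, _ | _⟩ := d <;> rfl

@[simp]
theorem sideDart_rightSide (d : E × Bool) : sideDart (rightSide d) = d := by
  obtain ⟨e, _ | _⟩ := d <;> rfl

theorem dartFlip_dartFlip (d : E × Bool) : dartFlip E (dartFlip E d) = d := by
  obtain ⟨e, _ | _⟩ := d <;> rfl

theorem arc_leftSide (d : E × Bool) : G.linkDiagram.arc (leftSide d) = rightSide (G.rot d) :=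
  G.medialArc_leftSide d

theorem arc_rightSide (d : E × Bool) :
    G.linkDiagram.arc (rightSide d) = leftSide (G.rot.symm d) :=
  G.medialArc_rightSide d

/-- Of the two half-arcs that form an arc of the medial diagram exactly one lies on the left side of
a dart; this dart represents both half-arcs. -/
def arcDart : E × Fin 4 → E × Bool
  | (e, 0) => (e, false)
  | (e, 1) => G.rot.symm (e, false)
  | (e, 2) => (e, true)
  | (e, 3) => G.rot.symm (e, true)

theorem arcDart_leftSide (d : E × Bool) : G.arcDart (leftSide d) = d := by
  obtain ⟨e, _ | _⟩ := d <;> rfl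

theorem arcDart_rightSide (d : E × Bool) : G.arcDart (rightSide d) = G.rot.symm d := by
  obtain ⟨e, _ | _⟩ := d <;> rfl

section Loops

variable [DecidableEq E] (S : Finset E)

/-- Reversal of the darts on the edges in `S`. -/
def flipOn : Equiv.Perm (E × Bool) :=
  Function.Involutive.toPerm (fun d => if d.1 ∈ S then dartFlip E d else d) fun ⟨e, b⟩ => by
    by_cases h : e ∈ S <;> simp [h, dartFlip]

theorem flipOn_apply (d : E × Bool) : flipOn S d = if d.1 ∈ S then dartFlip E d else d :=
  rfl

theorem flipOn_flipOn (d : E × Bool) : flipOn S (flipOn S d) = d :=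
  (flipOn S).left_inv d

theorem flipOn_empty : flipOn (∅ : Finset E) = 1 := by
  ext d <;> simp [flipOn_apply]

theorem flipOn_univ [Fintype E] : flipOn (Finset.univ : Finset E) = dartFlip E := by
  ext d <;> simp [flipOn_apply]

variable {S} in
theorem flipOn_insert {τ : E} (h : τ ∉ S) :
    flipOn (insert τ S) = flipOn S * Equiv.swap (τ, false) (τ, true) := by
  ext1 ⟨e, b⟩
  rcases eq_or_ne e τ with rfl | he
  · cases b <;> simp [flipOn_apply, h, dartFlip]
  · have hne (b' : Bool) : (e, b) ≠ (τ, b') := fun k => he (congrArg Prod.fst k)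
    rw [Equiv.Perm.mul_apply, Equiv.swap_apply_of_ne_of_ne (hne _) (hne _)]
    simp [flipOn_apply, he]

theorem smoothing_leftSide (d : E × Bool) :
    LinkDiagram.smoothing S (leftSide d) = rightSide (flipOn S d) := by
  obtain ⟨e, b⟩ := d
  by_cases h : e ∈ S <;> cases b <;>
    simp [LinkDiagram.smoothing, leftSide, rightSide, flipOn_apply, h, dartFlip]

theorem smoothing_rightSide (d : E × Bool) :
    LinkDiagram.smoothing S (rightSide d) = leftSide (flipOn S d) := by
  obtain ⟨e, b⟩ := d
  by_cases h : e ∈ S <;> cases b <;>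
    simp [LinkDiagram.smoothing, leftSide, rightSide, flipOn_apply, h, dartFlip]

/-- The permutation of the darts whose cycles are the loops of the state `S`. -/
def loopPerm : Equiv.Perm (E × Bool) :=
  G.rot⁻¹ * flipOn S

theorem loopPerm_apply (d : E × Bool) : G.loopPerm S d = G.rot.symm (flipOn S d) :=
  rfl

theorem loopSetoid_le_comap_arcDart :
    G.linkDiagram.loopSetoid S ≤
      (Equiv.Perm.SameCycle.setoid (G.loopPerm S)).comap G.arcDart := by
  refine G.linkDiagram.loopSetoid_le (fun h => ?_) fun h => ?_ <;>
    change (G.loopPerm S).SameCycle _ _ <;> rcases exists_side h with ⟨d, rfl⟩ | ⟨d, rfl⟩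
  · rw [arc_leftSide, arcDart_leftSide, arcDart_rightSide, Equiv.symm_apply_apply]
  · rw [arc_rightSide, arcDart_leftSide, arcDart_rightSide]
  · rw [smoothing_leftSide, arcDart_leftSide, arcDart_rightSide, ← loopPerm_apply]
    exact Equiv.Perm.sameCycle_apply_right.2 (Equiv.Perm.SameCycle.refl _ _)
  · rw [smoothing_rightSide, arcDart_leftSide, arcDart_rightSide,
      ← Equiv.Perm.sameCycle_apply_right, loopPerm_apply, flipOn_flipOn]

theorem loopSetoid_leftSide_loopPerm (d : E × Bool) :
    G.linkDiagram.loopSetoid S (leftSide d) (leftSide (G.loopPerm S d)) := by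
  have hsmoothing := G.linkDiagram.loopSetoid_smoothing S (leftSide d)
  have harc := G.linkDiagram.loopSetoid_arc S (rightSide (flipOn S d))
  rw [smoothing_leftSide] at hsmoothing
  rw [arc_rightSide] at harc
  exact Setoid.trans' _ hsmoothing harc

theorem loopSetoid_leftSide_iff {d d' : E × Bool} :
    G.linkDiagram.loopSetoid S (leftSide d) (leftSide d') ↔ (G.loopPerm S).SameCycle d d' := by
  refine ⟨fun h => ?_, fun h => ?_⟩
  · have := G.loopSetoid_le_comap_arcDart S h
    rwa [Setoid.comap_rel, arcDart_leftSide, arcDart_leftSide] at this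
  · exact sameCycle_setoid_le (t := (G.linkDiagram.loopSetoid S).comap leftSide)
      (G.loopSetoid_leftSide_loopPerm S) h

theorem card_quotient_loopSetoid : Nat.card (Quotient (G.linkDiagram.loopSetoid S)) =
    Nat.card (Quotient (Equiv.Perm.SameCycle.setoid (G.loopPerm S))) := by
  refine (card_quotient_eq_of_forall_exists leftSide
    (fun d d' => (G.loopSetoid_leftSide_iff S).symm) fun h => ?_).symm
  rcases exists_side h with ⟨d, rfl⟩ | ⟨d, rfl⟩
  · exact ⟨d, Setoid.refl' _ _⟩
  · refine ⟨G.rot.symm d, ?_⟩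
    rw [← arc_rightSide]
    exact Setoid.symm' _ (G.linkDiagram.loopSetoid_arc S _)

theorem selfTouching_iff {τ : E} :
    G.linkDiagram.SelfTouching S τ ↔ (G.loopPerm S).SameCycle (τ, false) (τ, true) :=
  G.loopSetoid_leftSide_iff S (d := (τ, false)) (d' := (τ, true))

theorem mergesOrSplits [Finite E] : G.linkDiagram.MergesOrSplits := by
  intro S τ hτ
  rw [selfTouching_iff, selfTouching_iff, loopPerm, loopPerm, flipOn_insert hτ, ← mul_assoc]
  exact sameCycle_mul_swap_iff (by simp)

end Loops

/-! ### Planarity of `K(G)` -/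

theorem isAlternating : G.linkDiagram.IsAlternating := by
  have left_under (d : E × Bool) : ¬ ((leftSide d).2 = 1 ∨ (leftSide d).2 = 3) := by
    obtain ⟨e, _ | _⟩ := d <;> simp [leftSide]
  have right_over (d : E × Bool) : (rightSide d).2 = 1 ∨ (rightSide d).2 = 3 := by
    obtain ⟨e, _ | _⟩ := d <;> simp [rightSide]
  intro h
  rcases exists_side h with ⟨d, rfl⟩ | ⟨d, rfl⟩
  · rw [arc_leftSide]
    exact iff_of_true (right_over _) (left_under _)
  · rw [arc_rightSide]
    exact iff_of_false (left_under _) (not_not.2 (right_over _))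

/-- The setoid whose classes are the components of `G` that contain an edge. -/
def dartComponent : Setoid (E × Bool) :=
  Relation.EqvGen.setoid fun d d' : E × Bool => d' = G.rot d ∨ d' = dartFlip E d

theorem dartComponent_rot (d : E × Bool) : G.dartComponent d (G.rot d) :=
  Relation.EqvGen.rel _ _ (.inl rfl)

theorem dartComponent_dartFlip (d : E × Bool) : G.dartComponent d (dartFlip E d) :=
  Relation.EqvGen.rel _ _ (.inr rfl)

theorem dartComponent_of_fst_eq {d d' : E × Bool} (h : d.1 = d'.1) : G.dartComponent d d' := by
  obtain ⟨e, b⟩ := d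
  obtain ⟨e', b'⟩ := d'
  obtain rfl : e = e' := h
  cases b <;> cases b'
  exacts [Setoid.refl' _ _, G.dartComponent_dartFlip (e, false),
    G.dartComponent_dartFlip (e, true), Setoid.refl' _ _]

theorem dartComponent_le {t : Setoid (E × Bool)} (hrot : ∀ d, t d (G.rot d))
    (hflip : ∀ d, t d (dartFlip E d)) : G.dartComponent ≤ t := by
  refine Setoid.eqvGen_le ?_
  rintro x y (rfl | rfl)
  exacts [hrot x, hflip x]

theorem card_projectionComponent :
    Nat.card G.linkDiagram.ProjectionComponent = Nat.card (Quotient G.dartComponent) := by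
  set t : Setoid (E × Fin 4) := Relation.EqvGen.setoid
    fun a b => b = G.linkDiagram.arc a ∨ b.1 = a.1
  have t_arc (a) : t a (G.linkDiagram.arc a) := Relation.EqvGen.rel _ _ (.inl rfl)
  have t_fst (a b : E × Fin 4) (h : b.1 = a.1) : t a b := Relation.EqvGen.rel _ _ (.inr h)
  have t_le : t ≤ G.dartComponent.comap sideDart := by
    refine Setoid.eqvGen_le ?_
    rintro x y (rfl | h) <;> rw [Setoid.comap_rel]
    · rcases exists_side x with ⟨d, rfl⟩ | ⟨d, rfl⟩
      · rw [arc_leftSide, sideDart_leftSide, sideDart_rightSide]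
        exact G.dartComponent_rot d
      · rw [arc_rightSide, sideDart_leftSide, sideDart_rightSide]
        simpa using Setoid.symm' _ (G.dartComponent_rot (G.rot.symm d))
    · have fst_sideDart (a : E × Fin 4) : (sideDart a).1 = a.1 := by
        rcases exists_side a with ⟨d, rfl⟩ | ⟨d, rfl⟩ <;> simp <;> rfl
      exact G.dartComponent_of_fst_eq (by rw [fst_sideDart, fst_sideDart, h])
  have le_t : G.dartComponent ≤ t.comap leftSide := by
    refine G.dartComponent_le (fun d => t.trans' (t_arc _) ?_) fun d => t_fst _ _ rfl
    rw [arc_leftSide]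
    exact t_fst _ _ rfl
  exact (card_quotient_eq_of_forall_exists (t := t) leftSide
    (fun d d' => ⟨fun h => le_t h, fun h => by simpa [Setoid.comap_rel] using t_le h⟩)
    fun h => ⟨(h.1, false), t_fst _ _ rfl⟩).symm

theorem leftSide_dartFlip_eq_rightSide_add_one (d : E × Bool) :
    leftSide (dartFlip E d) = ((rightSide d).1, (rightSide d).2 + 1) := by
  obtain ⟨e, _ | _⟩ := d <;> simp [leftSide, rightSide, dartFlip]

theorem rightSide_eq_leftSide_add_one (d : E × Bool) :
    rightSide d = ((leftSide d).1, (leftSide d).2 + 1) := by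
  obtain ⟨e, _ | _⟩ := d <;> rfl

/-- The setoid whose classes are the regions of the medial diagram. -/
def regionSetoid : Setoid (E × Fin 4) :=
  Relation.EqvGen.setoid fun a b : E × Fin 4 =>
    b = ((G.linkDiagram.arc a).1, (G.linkDiagram.arc a).2 + 1)

theorem regionSetoid_leftSide (d : E × Bool) :
    G.regionSetoid (leftSide d) (leftSide (dartFlip E (G.rot d))) := by
  refine Relation.EqvGen.rel _ _ ?_
  rw [arc_leftSide]
  exact leftSide_dartFlip_eq_rightSide_add_one _

theorem regionSetoid_rightSide (d : E × Bool) :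
    G.regionSetoid (rightSide d) (rightSide (G.rot.symm d)) := by
  refine Relation.EqvGen.rel _ _ ?_
  rw [arc_rightSide, rightSide_eq_leftSide_add_one]

theorem regionSetoid_le {t : Setoid (E × Fin 4)}
    (hleft : ∀ d, t (leftSide d) (leftSide (dartFlip E (G.rot d))))
    (hright : ∀ d, t (rightSide d) (rightSide (G.rot.symm d))) : G.regionSetoid ≤ t := by
  refine Setoid.eqvGen_le ?_
  rintro x y rfl
  rcases exists_side x with ⟨d, rfl⟩ | ⟨d, rfl⟩
  · convert hleft d using 1
    rw [arc_leftSide, leftSide_dartFlip_eq_rightSide_add_one]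
  · convert hright d using 1
    rw [arc_rightSide, rightSide_eq_leftSide_add_one]

/-- The node or the face of `G` that contains the region of the medial diagram to which a half-arc
belongs: a right half-arc lies on the boundary of the region of its node, a left half-arc on that of
the region inside its face. -/
def nodeOrFace : E × Fin 4 → Quotient (Equiv.Perm.SameCycle.setoid G.rot) ⊕
    Quotient (Equiv.Perm.SameCycle.setoid (G.rot * dartFlip E))
  | (e, 0) => .inr (Quotient.mk _ (e, true))
  | (e, 1) => .inl (Quotient.mk _ (e, false))
  | (e, 2) => .inr (Quotient.mk _ (e, false))
  | (e, 3) => .inl (Quotient.mk _ (e, true))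

theorem nodeOrFace_leftSide (d : E × Bool) :
    G.nodeOrFace (leftSide d) = .inr (Quotient.mk _ (dartFlip E d)) := by
  obtain ⟨e, _ | _⟩ := d <;> rfl

theorem nodeOrFace_rightSide (d : E × Bool) :
    G.nodeOrFace (rightSide d) = .inl (Quotient.mk _ d) := by
  obtain ⟨e, _ | _⟩ := d <;> rfl

theorem regionSetoid_le_ker_nodeOrFace : G.regionSetoid ≤ Setoid.ker G.nodeOrFace := by
  refine G.regionSetoid_le (fun d => ?_) fun d => ?_ <;> rw [Setoid.ker_def]
  · rw [nodeOrFace_leftSide, nodeOrFace_leftSide, dartFlip_dartFlip]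
    exact congrArg Sum.inr (Quotient.sound ⟨1, by simp [dartFlip_dartFlip]⟩)
  · rw [nodeOrFace_rightSide, nodeOrFace_rightSide]
    exact congrArg Sum.inl (Quotient.sound ⟨-1, by simp [Equiv.Perm.inv_def]⟩)

theorem card_region [Finite E] : Nat.card G.linkDiagram.Region =
    Nat.card (Quotient (Equiv.Perm.SameCycle.setoid G.rot)) +
      Nat.card (Quotient (Equiv.Perm.SameCycle.setoid (G.rot * dartFlip E))) := by
  refine card_quotient_eq_add (t := G.regionSetoid) rightSide (fun d => leftSide (dartFlip E d))
    (fun d d' => ⟨fun h => ?_, fun h => ?_⟩) (fun d d' => ⟨fun h => ?_, fun h => ?_⟩)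
    (fun d d' h => ?_) fun h => ?_
  · refine sameCycle_setoid_le (t := G.regionSetoid.comap rightSide)
      (fun d => Setoid.symm' _ ?_) h
    simpa [Setoid.comap_rel] using G.regionSetoid_rightSide (G.rot d)
  · have := G.regionSetoid_le_ker_nodeOrFace h
    rw [Setoid.ker_def, nodeOrFace_rightSide, nodeOrFace_rightSide] at this
    exact Quotient.exact (Sum.inl_injective this)
  · exact sameCycle_setoid_le (t := G.regionSetoid.comap fun d => leftSide (dartFlip E d))
      (fun d => G.regionSetoid_leftSide (dartFlip E d)) h
  · have := G.regionSetoid_le_ker_nodeOrFace h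
    rw [Setoid.ker_def, nodeOrFace_leftSide, nodeOrFace_leftSide, dartFlip_dartFlip,
      dartFlip_dartFlip] at this
    exact Quotient.exact (Sum.inr_injective this)
  · have := G.regionSetoid_le_ker_nodeOrFace h
    rw [Setoid.ker_def, nodeOrFace_rightSide, nodeOrFace_leftSide] at this
    exact Sum.inl_ne_inr this
  · rcases exists_side h with ⟨d, rfl⟩ | ⟨d, rfl⟩
    · exact .inr ⟨dartFlip E d, by rw [dartFlip_dartFlip]⟩
    · exact .inl ⟨d, Setoid.refl' _ _⟩

theorem isPlanar [Finite E] : G.linkDiagram.IsPlanar := by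
  rw [LinkDiagram.IsPlanar, card_region, G.euler, card_projectionComponent, dartComponent]
  ring

end PlaneGraph

/-! ### Euler's formula for spanning subgraphs -/

namespace PlaneGraph

variable {V E : Type*} (G : PlaneGraph V E)

/-- Two nodes lie in the same component of the spanning subgraph with edge set `S`. -/
def component (S : Finset E) : Setoid V :=
  Relation.EqvGen.setoid fun x y => ∃ e ∈ S, x = G.vert (e, false) ∧ y = G.vert (e, true)

variable {S : Finset E}

theorem component_edge {e : E} (he : e ∈ S) :
    G.component S (G.vert (e, false)) (G.vert (e, true)) :=
  Relation.EqvGen.rel _ _ ⟨e, he, rfl, rfl⟩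

theorem component_dartFlip {d : E × Bool} (hd : d.1 ∈ S) :
    G.component S (G.vert d) (G.vert (dartFlip E d)) := by
  obtain ⟨e, _ | _⟩ := d
  exacts [G.component_edge hd, Setoid.symm' _ (G.component_edge hd)]

theorem component_le {t : Setoid V}
    (h : ∀ e ∈ S, t (G.vert (e, false)) (G.vert (e, true))) : G.component S ≤ t := by
  refine Setoid.eqvGen_le ?_
  rintro x y ⟨e, he, rfl, rfl⟩
  exact h e he

theorem component_empty : G.component ∅ = ⊥ :=
  le_bot_iff.1 (G.component_le (by simp))

theorem component_insert [DecidableEq E] (S : Finset E) (τ : E) :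
    G.component (insert τ S) =
      identifyPair (G.component S) (G.vert (τ, false)) (G.vert (τ, true)) := by
  refine le_antisymm (G.component_le fun e he => ?_) (identifyPair_le_iff.2 ⟨?_, ?_⟩)
  · rcases Finset.mem_insert.1 he with rfl | he
    exacts [identifyPair_rel, le_identifyPair (G.component_edge he)]
  · exact G.component_le fun e he => G.component_edge (Finset.mem_insert_of_mem he)
  · exact G.component_edge (Finset.mem_insert_self τ S)

theorem vert_rot (d : E × Bool) : G.vert (G.rot d) = G.vert d :=
  ((G.sameCycle_iff _ _).1 ⟨1, by simp⟩).symm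

theorem vert_rot_symm (d : E × Bool) : G.vert (G.rot.symm d) = G.vert d := by
  rw [← vert_rot, Equiv.apply_symm_apply]

theorem component_flipOn [DecidableEq E] (S : Finset E) (d : E × Bool) :
    G.component S (G.vert d) (G.vert (flipOn S d)) := by
  rw [flipOn_apply]
  split_ifs with hd
  exacts [G.component_dartFlip hd, Setoid.refl' _ _]

theorem loopSetoid_le_comap_component [DecidableEq E] (S : Finset E) :
    G.linkDiagram.loopSetoid S ≤ (G.component S).comap fun h => G.vert (sideDart h) := by
  refine G.linkDiagram.loopSetoid_le (fun h => ?_) fun h => ?_ <;>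
    rw [Setoid.comap_rel] <;> rcases exists_side h with ⟨d, rfl⟩ | ⟨d, rfl⟩
  · rw [arc_leftSide, sideDart_leftSide, sideDart_rightSide, vert_rot]
  · rw [arc_rightSide, sideDart_leftSide, sideDart_rightSide, vert_rot_symm]
  · rw [smoothing_leftSide, sideDart_leftSide, sideDart_rightSide]
    exact G.component_flipOn S d
  · rw [smoothing_rightSide, sideDart_leftSide, sideDart_rightSide]
    exact G.component_flipOn S d

theorem card_quotient_eq_add_card_isolatedNode [Finite V] [Finite E] {s : Setoid (E × Bool)}
    {t : Setoid V} (hst : ∀ d d', s d d' ↔ t (G.vert d) (G.vert d'))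
    (ht : ∀ x : G.IsolatedNode, ∀ y, t x y → x = y) :
    Nat.card (Quotient t) = Nat.card (Quotient s) + Nat.card G.IsolatedNode := by
  rw [← Nat.card_congr (Setoid.quotientBotEquiv (α := G.IsolatedNode))]
  refine card_quotient_eq_add G.vert Subtype.val hst (fun x y => ⟨fun h => ?_, fun h => ?_⟩)
    (fun d x h => ?_) fun x => ?_
  · obtain rfl : x = y := h
    exact t.refl' _
  · exact Subtype.ext (ht x y h)
  · exact x.2 d (ht x _ (t.symm' h)).symm
  · by_cases hx : ∃ d, G.vert d = x
    · obtain ⟨d, rfl⟩ := hx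
      exact .inl ⟨d, t.refl' _⟩
    · exact .inr ⟨⟨x, not_exists.1 hx⟩, t.refl' _⟩

theorem card_nodes [Finite V] [Finite E] : Nat.card V =
    Nat.card (Quotient (Equiv.Perm.SameCycle.setoid G.rot)) + Nat.card G.IsolatedNode := by
  rw [← G.card_quotient_eq_add_card_isolatedNode (t := ⊥) G.sameCycle_iff fun x y h => h]
  exact (Nat.card_congr Setoid.quotientBotEquiv).symm

theorem dartComponent_of_vert_eq {d d' : E × Bool} (h : G.vert d = G.vert d') :
    G.dartComponent d d' :=
  sameCycle_setoid_le G.dartComponent_rot ((G.sameCycle_iff d d').2 h)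

/-- The component of a node, as a class of darts or, for an isolated node, as the node itself. -/
noncomputable def nodeComponent : V → Quotient G.dartComponent ⊕ V :=
  Function.extend G.vert (fun d => .inl (Quotient.mk _ d)) .inr

theorem nodeComponent_vert (d : E × Bool) :
    G.nodeComponent (G.vert d) = .inl (Quotient.mk _ d) := by
  refine Function.FactorsThrough.extend_apply (fun d d' h => ?_) _ d
  exact congrArg Sum.inl (Quotient.sound (G.dartComponent_of_vert_eq h))

theorem nodeComponent_isolatedNode (x : G.IsolatedNode) : G.nodeComponent x = .inr x.1 :=
  Function.extend_apply' _ _ _ (not_exists.2 x.2)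

theorem component_le_ker_nodeComponent (S : Finset E) :
    G.component S ≤ Setoid.ker G.nodeComponent :=
  G.component_le fun e _ => by
    rw [Setoid.ker_def, nodeComponent_vert, nodeComponent_vert]
    exact congrArg Sum.inl (Quotient.sound (G.dartComponent_dartFlip (e, false)))

theorem eq_of_component_isolatedNode (x : G.IsolatedNode) {y : V} (h : G.component S x y) :
    x = y := by
  have comp_eq := G.component_le_ker_nodeComponent S h
  rw [Setoid.ker_def, nodeComponent_isolatedNode] at comp_eq
  by_cases hy : ∃ d, G.vert d = y
  · obtain ⟨d, rfl⟩ := hy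
    exact absurd (comp_eq.trans (G.nodeComponent_vert d)) Sum.inr_ne_inl
  · rw [G.nodeComponent_isolatedNode ⟨y, not_exists.1 hy⟩] at comp_eq
    exact Sum.inr_injective comp_eq

theorem dartComponent_iff [Fintype E] {d d' : E × Bool} :
    G.dartComponent d d' ↔ G.component Finset.univ (G.vert d) (G.vert d') := by
  refine ⟨fun h => ?_, fun h => ?_⟩
  · refine G.dartComponent_le (t := (G.component Finset.univ).comap G.vert) (fun d => ?_)
      (fun d => ?_) h
    · rw [Setoid.comap_rel, vert_rot]
    · exact G.component_dartFlip (Finset.mem_univ _)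
  · have comp_eq := G.component_le_ker_nodeComponent _ h
    rw [Setoid.ker_def, nodeComponent_vert, nodeComponent_vert] at comp_eq
    exact Quotient.exact (Sum.inl_injective comp_eq)

theorem card_component_univ [Finite V] [Fintype E] :
    Nat.card (Quotient (G.component Finset.univ)) =
      Nat.card (Quotient G.dartComponent) + Nat.card G.IsolatedNode :=
  G.card_quotient_eq_add_card_isolatedNode (fun _ _ => G.dartComponent_iff)
    fun x _ => G.eq_of_component_isolatedNode x

section Euler

variable [Finite V] [DecidableEq E]

theorem card_loop_empty [Finite E] : Nat.card (G.linkDiagram.Loop ∅) = Nat.card V := by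
  rw [LinkDiagram.card_loop, card_quotient_loopSetoid, G.card_nodes, loopPerm, flipOn_empty,
    mul_one]
  congr 1
  exact card_quotient_eq_of_forall_exists id (fun d d' => Equiv.Perm.sameCycle_inv)
    fun d => ⟨d, Setoid.refl' _ _⟩

theorem card_loop_univ [Fintype E] : Nat.card (G.linkDiagram.Loop Finset.univ) =
    Nat.card (Quotient (Equiv.Perm.SameCycle.setoid (G.rot * dartFlip E))) +
      Nat.card G.IsolatedNode := by
  rw [LinkDiagram.card_loop, card_quotient_loopSetoid, loopPerm, flipOn_univ]
  congr 1
  have flip_inv : (dartFlip E)⁻¹ = dartFlip E := rfl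
  have conj_eq : G.rot⁻¹ * dartFlip E = dartFlip E * (G.rot * dartFlip E)⁻¹ * (dartFlip E)⁻¹ := by
    rw [mul_inv_rev, mul_assoc, mul_assoc, mul_inv_cancel_left, flip_inv]
  refine card_quotient_eq_of_forall_exists (dartFlip E) (fun d d' => ?_) fun d =>
    ⟨dartFlip E d, by rw [dartFlip_dartFlip]⟩
  change Equiv.Perm.SameCycle _ _ _ ↔ Equiv.Perm.SameCycle _ _ _
  rw [conj_eq, Equiv.Perm.sameCycle_conj, Equiv.Perm.sameCycle_inv, flip_inv]

/-- Twice the genus of the spanning subgraph with edge set `S`, whose boundary walks (one for each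
isolated node included) are the loops of the state `S`. -/
noncomputable def twiceGenus (S : Finset E) : ℤ :=
  2 * (Nat.card (Quotient (G.component S)) : ℤ) + S.card - Nat.card V
    - Nat.card (G.linkDiagram.Loop S)

theorem twiceGenus_mono [Finite E] : Monotone G.twiceGenus := by
  rw [Finset.monotone_iff_forall_le_insert]
  intro S τ hτ
  rw [twiceGenus, twiceGenus, Finset.card_insert_of_notMem hτ, component_insert]
  have hD := G.mergesOrSplits
  by_cases hS : G.linkDiagram.SelfTouching S τ
  · have connected : G.component S (G.vert (τ, false)) (G.vert (τ, true)) :=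
      G.loopSetoid_le_comap_component S hS
    rw [identifyPair_eq_self connected]
    have := LinkDiagram.card_loop_insert_of_split hD hτ hS
    omega
  · have := LinkDiagram.card_loop_insert_of_merge hD hτ hS
    by_cases hk : G.component S (G.vert (τ, false)) (G.vert (τ, true))
    · rw [identifyPair_eq_self hk]
      omega
    · have := card_quotient_identifyPair hk
      omega

theorem twiceGenus_empty [Finite E] : G.twiceGenus ∅ = 0 := by
  rw [twiceGenus, component_empty, Nat.card_congr Setoid.quotientBotEquiv, card_loop_empty,
    Finset.card_empty]
  push_cast
  ring

theorem twiceGenus_univ [Fintype E] : G.twiceGenus Finset.univ = 0 := by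
  have euler := G.euler
  rw [← dartComponent, Nat.card_eq_fintype_card (α := E)] at euler
  rw [twiceGenus, card_component_univ, card_loop_univ, G.card_nodes, Finset.card_univ]
  omega

theorem card_loop_add_card [Finite E] (S : Finset E) :
    Nat.card (G.linkDiagram.Loop S) + Nat.card V =
      2 * Nat.card (Quotient (G.component S)) + S.card := by
  have := Fintype.ofFinite E
  have ge_zero := G.twiceGenus_empty ▸ G.twiceGenus_mono (Finset.empty_subset S)
  have le_zero := G.twiceGenus_univ ▸ G.twiceGenus_mono (Finset.subset_univ S)
  rw [twiceGenus] at ge_zero le_zero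
  omega

end Euler

end PlaneGraph

/-! ### Labels of loops -/

namespace LoopLabel

theorem mul_eq_some_iff {a b c : LoopLabel} :
    mul a b = some c ↔ (a = one ∧ c = b) ∨ (b = one ∧ c = a) := by
  cases a <;> cases b <;> cases c <;> simp [mul]

theorem mk_mem_comul_iff {a b c : LoopLabel} :
    (b, c) ∈ comul a ↔ (b = X ∧ c = a) ∨ (c = X ∧ b = a) := by
  cases a <;> cases b <;> cases c <;> simp [comul]

end LoopLabel

namespace LinkDiagram

section Label

variable {X C : Type*} [DecidableEq X] {D : LinkDiagram X C} {S T : Finset X} {τ : X}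

/-- A point of a diagram, on the projection (given by a half-arc) or on a crossingless circle. It
specifies a loop in every state. -/
abbrev Point (X C : Type*) : Type _ := X × Fin 4 ⊕ C

/-- A point on one of the two strands at the crossing `τ`, for either smoothing. -/
abbrev firstStrand (τ : X) : Point X C := .inl (τ, 0)

/-- A point on the other strand at the crossing `τ`, for either smoothing. -/
abbrev secondStrand (τ : X) : Point X C := .inl (τ, 2)

variable (D) in
/-- The loop of the state `S` through a point. -/
def loopOf (S : Finset X) : Point X C → D.Loop S :=
  Sum.elim (D.loopAt S) (D.loopCircle S)

theorem loopOf_surjective (S : Finset X) : Function.Surjective (D.loopOf S) := by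
  rintro (l | c)
  · obtain ⟨h, rfl⟩ := Quotient.exists_rep l
    exact ⟨.inl h, rfl⟩
  · exact ⟨.inr c, rfl⟩

theorem loopAt_eq_iff {h h' : X × Fin 4} :
    D.loopAt S h = D.loopAt S h' ↔ D.loopSetoid S h h' :=
  Sum.inl_injective.eq_iff.trans Quotient.eq

theorem loopAt_ne_loopCircle (h : X × Fin 4) (c : C) : D.loopAt S h ≠ D.loopCircle S c :=
  Sum.inl_ne_inr

theorem loopCircle_inj {c c' : C} : D.loopCircle S c = D.loopCircle S c' ↔ c = c' :=
  Sum.inr_injective.eq_iff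

theorem selfTouching_iff_loopOf_eq :
    D.SelfTouching S τ ↔ D.loopOf S (firstStrand τ) = D.loopOf S (secondStrand τ) :=
  loopAt_eq_iff.symm

theorem loopOf_eq_iff_of_eq_identifyPair {a b : X × Fin 4}
    (h : D.loopSetoid T = identifyPair (D.loopSetoid S) a b) (p q : Point X C) :
    D.loopOf T p = D.loopOf T q ↔ D.loopOf S p = D.loopOf S q ∨
      (D.loopOf S p = D.loopOf S (.inl a) ∧ D.loopOf S (.inl b) = D.loopOf S q) ∨
      (D.loopOf S p = D.loopOf S (.inl b) ∧ D.loopOf S (.inl a) = D.loopOf S q) := by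
  rcases p with p | p <;> rcases q with q | q
  · simp only [loopOf, Sum.elim_inl, loopAt_eq_iff]
    rw [h, identifyPair_iff]
  all_goals simp [loopOf, loopAt_ne_loopCircle, (loopAt_ne_loopCircle _ _).symm, loopCircle_inj]

theorem loopOf_insert_eq_iff_of_merge (hD : D.MergesOrSplits) (hτ : τ ∉ S)
    (h : ¬ D.SelfTouching S τ) (p q : Point X C) :
    D.loopOf (insert τ S) p = D.loopOf (insert τ S) q ↔ D.loopOf S p = D.loopOf S q ∨
      (D.loopOf S p = D.loopOf S (firstStrand τ) ∧
        D.loopOf S (secondStrand τ) = D.loopOf S q) ∨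
      (D.loopOf S p = D.loopOf S (secondStrand τ) ∧
        D.loopOf S (firstStrand τ) = D.loopOf S q) :=
  loopOf_eq_iff_of_eq_identifyPair (loopSetoid_insert_of_merge hD hτ h) p q

theorem loopOf_eq_iff_of_selfTouching (h : D.SelfTouching S τ) (p q : Point X C) :
    D.loopOf S p = D.loopOf S q ↔ D.loopOf (insert τ S) p = D.loopOf (insert τ S) q ∨
      (D.loopOf (insert τ S) p = D.loopOf (insert τ S) (firstStrand τ) ∧
        D.loopOf (insert τ S) (secondStrand τ) = D.loopOf (insert τ S) q) ∨
      (D.loopOf (insert τ S) p = D.loopOf (insert τ S) (secondStrand τ) ∧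
        D.loopOf (insert τ S) (firstStrand τ) = D.loopOf (insert τ S) q) :=
  loopOf_eq_iff_of_eq_identifyPair (loopSetoid_of_selfTouching h) p q

namespace EnhancedState

/-- The label of the loop through a point. -/
def label (s : D.EnhancedState) (p : Point X C) : LoopLabel := s.2 (D.loopOf s.1 p)

theorem ext_label {s t : D.EnhancedState} (h : s.1 = t.1) (hl : ∀ p, s.label p = t.label p) :
    s = t := by
  obtain ⟨S, a⟩ := s
  obtain ⟨T, b⟩ := t
  obtain rfl : S = T := h
  exact congrArg (Sigma.mk S) ((loopOf_surjective S).injective_comp_right (funext hl))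

theorem label_congr (s : D.EnhancedState) {p q : Point X C}
    (h : D.loopOf s.1 p = D.loopOf s.1 q) : s.label p = s.label q :=
  congrArg s.2 h

open Classical in
/-- Change the label of the loop through a point. -/
noncomputable def setLabel (s : D.EnhancedState) (p : Point X C) (x : LoopLabel) :
    D.EnhancedState :=
  ⟨s.1, Function.update s.2 (D.loopOf s.1 p) x⟩

variable (s : D.EnhancedState) (p q : Point X C) (x y : LoopLabel)

@[simp] theorem setLabel_fst : (s.setLabel p x).1 = s.1 := rfl

open Classical in
theorem label_setLabel : (s.setLabel p x).label q =
    if D.loopOf s.1 q = D.loopOf s.1 p then x else s.label q :=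
  Function.update_apply s.2 _ x _

@[simp] theorem label_setLabel_self : (s.setLabel p x).label p = x := by
  rw [label_setLabel, if_pos rfl]

variable {s p x} in
theorem setLabel_eq_self (h : s.label p = x) : s.setLabel p x = s :=
  congrArg (Sigma.mk s.1) (by classical exact Function.update_eq_self_iff.2 h.symm)

@[simp] theorem setLabel_setLabel : (s.setLabel p x).setLabel p y = s.setLabel p y :=
  congrArg (Sigma.mk s.1) (by classical exact Function.update_idem ..)

theorem setLabel_comm : (s.setLabel p x).setLabel q x = (s.setLabel q x).setLabel p x := by
  refine ext_label rfl fun r => ?_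
  simp only [label_setLabel, setLabel_fst]
  grind

variable {p q} in
theorem setLabel_congr (h : D.loopOf s.1 p = D.loopOf s.1 q) : s.setLabel p x = s.setLabel q x := by
  rw [setLabel, setLabel, h]

variable (D) in
/-- The state `S` with all labels `1`. -/
def allOne (S : Finset X) : D.EnhancedState := ⟨S, fun _ => .one⟩

@[simp] theorem allOne_fst (S : Finset X) : (allOne D S).1 = S := rfl

@[simp] theorem label_allOne (S : Finset X) (p : Point X C) : (allOne D S).label p = .one := rfl

open Classical in
theorem induction_label [Finite X] [Finite C] {P : D.EnhancedState → Prop}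
    (allOne : ∀ S, P (allOne D S))
    (setLabel : ∀ s p, s.label p = .one → P s → P (s.setLabel p .X)) (s : D.EnhancedState) :
    P s := by
  obtain ⟨S, a⟩ := s
  have := Fintype.ofFinite (D.Loop S)
  suffices h : ∀ T : Finset (D.Loop S), P ⟨S, T.piecewise a fun _ => .one⟩ by
    simpa using h Finset.univ
  intro T
  induction T using Finset.induction_on with
  | empty => exact (Finset.piecewise_empty a _).symm ▸ allOne S
  | insert l T hl ih =>
    have label_l : T.piecewise a (fun _ => .one) l = .one := Finset.piecewise_eq_of_notMem _ _ _ hl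
    rw [Finset.piecewise_insert]
    obtain ⟨p, rfl⟩ := loopOf_surjective S l
    cases ha : a (D.loopOf S p) with
    | one => rwa [Function.update_eq_self_iff.2 label_l.symm]
    | X => exact setLabel ⟨S, _⟩ p label_l ih

end EnhancedState

end Label

end LinkDiagram

/-! ### The terms of the partial differentials -/

namespace LinkDiagram

section IsPartialTerm

open EnhancedState

variable {X C : Type*} [DecidableEq X] {D : LinkDiagram X C} {S : Finset X} {τ : X}
  {s s' : D.EnhancedState}

theorem forall_label_eq_iff :
    ((∀ h, (∀ k, D.loopAt s.1 h ≠ D.loopAt s.1 (τ, k)) → s'.labelAt h = s.labelAt h) ∧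
      ∀ c : C, s'.2 (D.loopCircle s'.1 c) = s.2 (D.loopCircle s.1 c)) ↔
    ∀ p, D.loopOf s.1 p ≠ D.loopOf s.1 (firstStrand τ) →
      D.loopOf s.1 p ≠ D.loopOf s.1 (secondStrand τ) → s'.label p = s.label p := by
  constructor
  · rintro ⟨hhalf, hcircle⟩ (h | c) hfirst hsecond
    · refine hhalf h fun k => ?_
      rcases D.loopSetoid_zero_or_two s.1 τ k with hk | hk
      · rw [← loopAt_eq_iff.2 hk]
        exact hfirst
      · rw [← loopAt_eq_iff.2 hk]
        exact hsecond
    · exact hcircle c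
  · exact fun h => ⟨fun a ha => h (.inl a) (ha 0) (ha 2),
      fun c => h (.inr c) Sum.inr_ne_inl Sum.inr_ne_inl⟩

theorem isPartialTerm_iff_of_merge (hD : D.MergesOrSplits) (hτ : τ ∉ s.1)
    (h : ¬ D.SelfTouching s.1 τ) :
    D.IsPartialTerm τ s s' ↔ s'.1 = insert τ s.1 ∧
      (∀ p, D.loopOf s.1 p ≠ D.loopOf s.1 (firstStrand τ) →
        D.loopOf s.1 p ≠ D.loopOf s.1 (secondStrand τ) → s'.label p = s.label p) ∧
      ((s.label (firstStrand τ) = .one ∧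
          s'.label (firstStrand τ) = s.label (secondStrand τ)) ∨
        (s.label (secondStrand τ) = .one ∧
          s'.label (firstStrand τ) = s.label (firstStrand τ))) := by
  rw [← forall_label_eq_iff, ← LoopLabel.mul_eq_some_iff, IsPartialTerm]
  have hne : D.loopAt s.1 (τ, 0) ≠ D.loopAt s.1 (τ, 2) := loopAt_eq_iff.not.2 h
  have heq : s'.1 = insert τ s.1 → D.loopAt s'.1 (τ, 0) = D.loopAt s'.1 (τ, 2) := fun hs' =>
    loopAt_eq_iff.2 (hs' ▸ (hD _ τ hτ).2 h)
  simp only [label, loopOf, labelAt, Sum.elim_inl]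
  tauto

theorem isPartialTerm_iff_of_split (hD : D.MergesOrSplits) (hτ : τ ∉ s.1)
    (h : D.SelfTouching s.1 τ) :
    D.IsPartialTerm τ s s' ↔ s'.1 = insert τ s.1 ∧
      (∀ p, D.loopOf s.1 p ≠ D.loopOf s.1 (firstStrand τ) →
        D.loopOf s.1 p ≠ D.loopOf s.1 (secondStrand τ) → s'.label p = s.label p) ∧
      ((s'.label (firstStrand τ) = .X ∧
          s'.label (secondStrand τ) = s.label (firstStrand τ)) ∨
        (s'.label (secondStrand τ) = .X ∧
          s'.label (firstStrand τ) = s.label (firstStrand τ))) := by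
  rw [← forall_label_eq_iff, ← LoopLabel.mk_mem_comul_iff, IsPartialTerm]
  have heq : D.loopAt s.1 (τ, 0) = D.loopAt s.1 (τ, 2) := loopAt_eq_iff.2 h
  have hne : s'.1 = insert τ s.1 → D.loopAt s'.1 (τ, 0) ≠ D.loopAt s'.1 (τ, 2) := fun hs' =>
    loopAt_eq_iff.not.2 (hs' ▸ not_selfTouching_insert hD hτ h)
  simp only [label, loopOf, labelAt, Sum.elim_inl]
  tauto

theorem label_eq_X_of_isPartialTerm (hD : D.MergesOrSplits) (h : D.IsPartialTerm τ s s')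
    {p : Point X C} (hp : s.label p = .X) : s'.label p = .X := by
  have label_s := fun q => s.label_congr (p := p) (q := q)
  have label_s' := fun q => s'.label_congr (p := p) (q := q)
  by_cases htouch : D.SelfTouching s.1 τ
  · obtain ⟨hS, hout, hstrand⟩ := (isPartialTerm_iff_of_split hD h.1 htouch).1 h
    have loop_iff := loopOf_eq_iff_of_selfTouching htouch p
    rw [hS] at label_s'
    rw [selfTouching_iff_loopOf_eq] at htouch
    grind
  · obtain ⟨hS, hout, hstrand⟩ := (isPartialTerm_iff_of_merge hD h.1 htouch).1 h
    have loop_iff := loopOf_insert_eq_iff_of_merge hD h.1 htouch p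
    rw [hS] at label_s'
    grind

theorem isPartialTerm_setLabel (hD : D.MergesOrSplits) (h : D.IsPartialTerm τ s s')
    {p : Point X C} (hp : s.label p = s'.label p) (y : LoopLabel) :
    D.IsPartialTerm τ (s.setLabel p y) (s'.setLabel p y) := by
  have label_s := fun q => s.label_congr (p := p) (q := q)
  have label_s' := fun q => s'.label_congr (p := p) (q := q)
  by_cases htouch : D.SelfTouching s.1 τ
  · obtain ⟨hS, hout, hstrand⟩ := (isPartialTerm_iff_of_split hD h.1 htouch).1 h
    refine (isPartialTerm_iff_of_split (s := s.setLabel p y) hD h.1 htouch).2 ⟨hS, ?_⟩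
    have loop_iff := loopOf_eq_iff_of_selfTouching htouch
    have hne := not_selfTouching_insert hD h.1 htouch
    simp only [label_setLabel, setLabel_fst]
    rw [selfTouching_iff_loopOf_eq] at htouch hne
    grind
  · obtain ⟨hS, hout, hstrand⟩ := (isPartialTerm_iff_of_merge hD h.1 htouch).1 h
    refine (isPartialTerm_iff_of_merge (s := s.setLabel p y) hD h.1 htouch).2 ⟨hS, ?_⟩
    have loop_iff := loopOf_insert_eq_iff_of_merge hD h.1 htouch
    simp only [label_setLabel, setLabel_fst]
    rw [selfTouching_iff_loopOf_eq] at htouch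
    grind

theorem isPartialTerm_setLabel_X_iff (hD : D.MergesOrSplits) {p : Point X C}
    (hp : s.label p = .one) :
    D.IsPartialTerm τ (s.setLabel p .X) s' ↔
      s'.label p = .X ∧ D.IsPartialTerm τ s (s'.setLabel p .one) := by
  constructor
  · intro h
    have hX := label_eq_X_of_isPartialTerm hD h (label_setLabel_self s p _)
    have h' := isPartialTerm_setLabel hD h ((label_setLabel_self s p _).trans hX.symm) .one
    rw [setLabel_setLabel, setLabel_eq_self hp] at h'
    exact ⟨hX, h'⟩
  · rintro ⟨hX, h⟩
    have h' := isPartialTerm_setLabel hD h (hp.trans (label_setLabel_self s' p _).symm) .X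
    rwa [setLabel_setLabel, setLabel_eq_self hX] at h'

theorem isPartialTerm_allOne_iff_of_merge (hD : D.MergesOrSplits) (hτ : τ ∉ S)
    (h : ¬ D.SelfTouching S τ) :
    D.IsPartialTerm τ (allOne D S) s' ↔ s' = allOne D (insert τ S) := by
  rw [isPartialTerm_iff_of_merge hD hτ h]
  constructor
  · rintro ⟨hS, hout, hstrand⟩
    refine ext_label hS fun p => ?_
    have loop_iff := loopOf_insert_eq_iff_of_merge hD hτ h p (firstStrand τ)
    have label_s' := s'.label_congr (p := p) (q := firstStrand τ)
    simp only [allOne_fst, label_allOne] at *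
    rw [hS] at label_s'
    grind
  · rintro rfl
    simp

theorem isPartialTerm_allOne_iff_of_split (hD : D.MergesOrSplits) (hτ : τ ∉ S)
    (h : D.SelfTouching S τ) :
    D.IsPartialTerm τ (allOne D S) s' ↔
      s' = (allOne D (insert τ S)).setLabel (firstStrand τ) .X ∨
        s' = (allOne D (insert τ S)).setLabel (secondStrand τ) .X := by
  have hne := not_selfTouching_insert hD hτ h
  have loop_iff := fun p => loopOf_eq_iff_of_selfTouching h p (firstStrand τ)
  rw [isPartialTerm_iff_of_split hD hτ h]
  rw [selfTouching_iff_loopOf_eq] at h hne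
  constructor
  · rintro ⟨hS, hout, hstrand⟩
    have label_s' := fun p q => s'.label_congr (p := p) (q := q)
    simp only [allOne_fst, label_allOne] at *
    rw [hS] at label_s'
    refine hstrand.imp (fun h => ext_label hS fun p => ?_) fun h => ext_label hS fun p => ?_
    all_goals
      simp only [label_setLabel, allOne_fst, label_allOne]
      grind
  · rintro (rfl | rfl)
    all_goals
      simp only [label_setLabel, setLabel_fst, allOne_fst, label_allOne]
      grind

end IsPartialTerm

end LinkDiagram

/-! ### The degree -/

namespace LoopLabel

/-- The degree of a basis element of `k[X]/(X²)`, for the grading in which multiplication and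
comultiplication have degree `-1`. -/
def degree : LoopLabel → ℤ
  | one => 1
  | X => -1

end LoopLabel

namespace LinkDiagram

section Degree

open EnhancedState

variable {X C : Type*} [DecidableEq X] {D : LinkDiagram X C} {S : Finset X} {τ : X}
  {s s' : D.EnhancedState}

theorem nB_of_isPartialTerm (h : D.IsPartialTerm τ s s') : s'.nB = s.nB + 1 := by
  rw [nB, nB, h.2.1, Finset.card_insert_of_notMem h.1]

namespace EnhancedState

theorem lam_mk [Fintype (D.Loop S)] (a : D.Loop S → LoopLabel) :
    lam (⟨S, a⟩ : D.EnhancedState) = ∑ l, (a l).degree := by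
  have degree_eq (a : LoopLabel) :
      a.degree = (if a = .one then 1 else 0) - (if a = .X then 1 else 0) := by
    cases a <;> rfl
  simp only [degree_eq, Finset.sum_sub_distrib, Finset.sum_boole, lam, Nat.card_eq_fintype_card,
    Fintype.card_subtype]

variable [Finite X] [Finite C]

theorem jdeg_allOne (S : Finset X) : (allOne D S).jdeg = S.card + Nat.card (D.Loop S) := by
  have : Fintype (D.Loop S) := Fintype.ofFinite _
  simp [jdeg, nB, allOne, lam_mk, LoopLabel.degree, Nat.card_eq_fintype_card]

theorem jdeg_setLabel (s : D.EnhancedState) (p : Point X C) (x : LoopLabel) :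
    (s.setLabel p x).jdeg = s.jdeg + (x.degree - (s.label p).degree) := by
  classical
  obtain ⟨S, a⟩ := s
  have : Fintype (D.Loop S) := Fintype.ofFinite _
  set l := D.loopOf S p with hl
  have sum_eq (b : D.Loop S → LoopLabel) :
      ∑ k, (b k).degree = (b l).degree + ∑ k ∈ {l}ᶜ, (b k).degree :=
    Fintype.sum_eq_add_sum_compl _ _
  have sum_compl_eq : ∑ k ∈ {l}ᶜ, (Function.update a l x k).degree = ∑ k ∈ {l}ᶜ, (a k).degree :=
    Finset.sum_congr rfl fun k hk => by rw [Function.update_of_ne (by simpa using hk)]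
  simp only [jdeg, setLabel, label, nB, lam_mk, ← hl]
  rw [sum_eq, sum_eq, Function.update_self, sum_compl_eq]
  ring

end EnhancedState

variable [Finite X] [Finite C]

theorem jdeg_of_isPartialTerm (hD : D.MergesOrSplits) (h : D.IsPartialTerm τ s s') :
    s'.jdeg = s.jdeg := by
  induction s using induction_label generalizing s' with
  | allOne S =>
    have hτ : τ ∉ S := h.1
    by_cases htouch : D.SelfTouching S τ
    · have card_loop := card_loop_insert_of_split hD hτ htouch
      rcases (isPartialTerm_allOne_iff_of_split hD hτ htouch).1 h with rfl | rfl
      all_goals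
        rw [jdeg_setLabel, jdeg_allOne, jdeg_allOne, label_allOne, card_loop,
          Finset.card_insert_of_notMem hτ, LoopLabel.degree, LoopLabel.degree]
        push_cast
        ring
    · have card_loop := card_loop_insert_of_merge hD hτ htouch
      obtain rfl := (isPartialTerm_allOne_iff_of_merge hD hτ htouch).1 h
      rw [jdeg_allOne, jdeg_allOne, Finset.card_insert_of_notMem hτ, ← card_loop]
      push_cast
      ring
  | setLabel s p hp ih =>
    obtain ⟨hX, h'⟩ := (isPartialTerm_setLabel_X_iff hD hp).1 h
    rw [jdeg_setLabel, ← ih h', jdeg_setLabel, hp, hX]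
    ring

end Degree

end LinkDiagram

/-! ### The partial differentials commute -/

namespace LinkDiagram

section Operators

open EnhancedState

variable {X C : Type*} [LinearOrder X] {R : Type*} [CommRing R] {D : LinkDiagram X C}
  {S : Finset X} {σ τ : X}

open Classical in
variable (R) in
/-- Multiplication by `X` on the tensor factor of the loop through a point. -/
noncomputable def mulX (p : Point X C) : Module.End R (D.Chain R) where
  toFun f s := if s.label p = .X then f (s.setLabel p .one) else 0
  map_add' f g := by
    funext s
    by_cases h : s.label p = .X <;> simp [h]
  map_smul' a f := by
    funext s
    by_cases h : s.label p = .X <;> simp [h]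

open Classical in
theorem mulX_apply (p : Point X C) (f : D.Chain R) (s : D.EnhancedState) :
    mulX R p f s = if s.label p = .X then f (s.setLabel p .one) else 0 := rfl

theorem commute_mulX (p q : Point X C) : Commute (mulX R p) (mulX (D := D) R q) := by
  refine LinearMap.ext fun f => funext fun s => ?_
  simp only [Module.End.mul_apply, mulX_apply, label_setLabel, setLabel_comm s q p]
  grind

open Classical in
theorem mulX_single {s : D.EnhancedState} {p : Point X C} (h : s.label p = .one) :
    mulX R p (Pi.single s 1) = Pi.single (s.setLabel p .X) 1 := by
  funext t
  have eq_iff : t = s.setLabel p .X ↔ t.label p = .X ∧ t.setLabel p .one = s := by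
    constructor
    · rintro rfl
      exact ⟨label_setLabel_self .., by rw [setLabel_setLabel, setLabel_eq_self h]⟩
    · rintro ⟨hX, rfl⟩
      rw [setLabel_setLabel, setLabel_eq_self hX]
  rw [mulX_apply, Pi.single_apply, Pi.single_apply, ← ite_and]
  simp only [eq_iff]

open Classical in
theorem mulX_single_eq_zero {s : D.EnhancedState} {p : Point X C} (h : s.label p = .X) :
    mulX R p (Pi.single s 1) = 0 := by
  funext t
  rw [mulX_apply, Pi.single_apply, ← ite_and, if_neg, Pi.zero_apply]
  rintro ⟨-, rfl⟩
  rw [label_setLabel_self] at h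
  cases h

open Classical in
variable (R D) in
/-- The basis element of the state `S` with all labels `1`. -/
noncomputable def unitChain (S : Finset X) : D.Chain R := Pi.single (allOne D S) 1

theorem mulX_unitChain_congr {p q : Point X C} (h : D.loopOf S p = D.loopOf S q) :
    mulX R p (unitChain R D S) = mulX R q (unitChain R D S) := by
  rw [unitChain, mulX_single rfl, mulX_single rfl, setLabel_congr (allOne D S) _ h]

variable (R) in
/-- Multiplication by `Δ(1) = 1 ⊗ X + X ⊗ 1` on the tensor factors of the two strands at a site. -/
noncomputable def mulComul (τ : X) : Module.End R (D.Chain R) :=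
  mulX R (firstStrand τ) + mulX R (secondStrand τ)

theorem mulComul_apply (τ : X) (f : D.Chain R) :
    mulComul R τ f = mulX R (firstStrand τ) f + mulX R (secondStrand τ) f := rfl

open Classical in
variable (R) in
/-- The operator by which the partial differential at the site `τ` of the state `S` acts on the
units: multiplication by `Δ(1)` if a loop splits, and the identity if two loops merge. -/
noncomputable def siteOp (S : Finset X) (τ : X) : Module.End R (D.Chain R) :=
  if D.SelfTouching S τ then mulComul R τ else 1

theorem commute_mulComul {A : Module.End R (D.Chain R)} (hA : ∀ p, Commute A (mulX R p)) (τ : X) :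
    Commute A (mulComul R τ) :=
  (hA _).add_right (hA _)

theorem commute_siteOp {A : Module.End R (D.Chain R)} (hA : ∀ p, Commute A (mulX R p))
    (S : Finset X) (τ : X) : Commute A (siteOp R S τ) := by
  rw [siteOp]
  split_ifs
  exacts [commute_mulComul hA τ, Commute.one_right A]

variable (D) in
/-- The unordered pair of the loops of the state `S` through the two strands at `τ`. -/
def strandLoops (S : Finset X) (τ : X) : Sym2 (D.Loop S) :=
  s(D.loopOf S (firstStrand τ), D.loopOf S (secondStrand τ))

theorem mulComul_unitChain_congr (h : D.strandLoops S σ = D.strandLoops S τ) :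
    mulComul R σ (unitChain R D S) = mulComul R τ (unitChain R D S) := by
  rw [mulComul_apply, mulComul_apply]
  rcases Sym2.eq_iff.1 h with ⟨h₁, h₂⟩ | ⟨h₁, h₂⟩
  · rw [mulX_unitChain_congr h₁, mulX_unitChain_congr h₂]
  · rw [mulX_unitChain_congr h₁, mulX_unitChain_congr h₂, add_comm]

theorem strandLoops_insert_insert_of_merge_split (hD : D.MergesOrSplits) (hτ : τ ∉ S)
    (h : ¬ D.SelfTouching S τ) (h' : ¬ D.SelfTouching S σ)
    (hσ : D.SelfTouching (insert τ S) σ) (hT : ¬ D.SelfTouching (insert σ (insert τ S)) τ) :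
    D.strandLoops (insert σ (insert τ S)) σ = D.strandLoops (insert σ (insert τ S)) τ := by
  have merge := loopOf_insert_eq_iff_of_merge hD hτ h
  have split := loopOf_eq_iff_of_selfTouching hσ
  rw [selfTouching_iff_loopOf_eq] at h' hσ hT
  have mem_merge := (merge _ _).1 hσ
  have first_eq : D.loopOf (insert τ S) (firstStrand τ) = D.loopOf (insert τ S) (firstStrand σ) :=
    (merge _ _).2 (by grind)
  have second_eq :
      D.loopOf (insert τ S) (secondStrand τ) = D.loopOf (insert τ S) (firstStrand σ) :=
    (merge _ _).2 (by grind)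
  have second_mem := (split _ _).1 second_eq
  rw [strandLoops, strandLoops, Sym2.eq_iff]
  grind

theorem strandLoops_insert_insert_of_split_merge (hD : D.MergesOrSplits) (hσ : σ ∉ insert τ S)
    (h : D.SelfTouching S τ) (h' : D.SelfTouching S σ)
    (hτσ : ¬ D.SelfTouching (insert τ S) σ) (hT : D.SelfTouching (insert σ (insert τ S)) τ) :
    D.strandLoops (insert σ (insert τ S)) σ = D.strandLoops (insert σ (insert τ S)) τ := by
  have merge := loopOf_insert_eq_iff_of_merge hD hσ hτσ
  have split := loopOf_eq_iff_of_selfTouching h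
  rw [selfTouching_iff_loopOf_eq] at h' hτσ hT
  have mem_split := (split _ _).1 h'
  have strands_eq : D.loopOf (insert σ (insert τ S)) (firstStrand σ) =
      D.loopOf (insert σ (insert τ S)) (secondStrand σ) := (merge _ _).2 (by grind)
  have first_eq : D.loopOf (insert σ (insert τ S)) (firstStrand σ) =
      D.loopOf (insert σ (insert τ S)) (firstStrand τ) := (merge _ _).2 (by grind)
  rw [strandLoops, strandLoops, ← strands_eq, ← hT, first_eq]

theorem End_ext_of_commute_mulX [Finite X] [Finite C] {A B : Module.End R (D.Chain R)}
    (hA : ∀ p, Commute A (mulX R p)) (hB : ∀ p, Commute B (mulX R p))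
    (h : ∀ S, A (unitChain R D S) = B (unitChain R D S)) : A = B := by
  classical
  refine LinearMap.pi_ext' fun s => LinearMap.ext_ring ?_
  simp only [LinearMap.comp_apply, LinearMap.single_apply]
  induction s using induction_label with
  | allOne S => exact h S
  | setLabel s p hp ih =>
    rw [← mulX_single hp, ← Module.End.mul_apply, ← Module.End.mul_apply, (hA p).eq, (hB p).eq,
      Module.End.mul_apply, Module.End.mul_apply, ih]

open Classical in
theorem card_loop_insert [Finite X] [Finite C] (hD : D.MergesOrSplits) (hτ : τ ∉ S) :
    (Nat.card (D.Loop (insert τ S)) : ℤ) =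
      Nat.card (D.Loop S) + if D.SelfTouching S τ then 1 else -1 := by
  split_ifs with h
  · rw [card_loop_insert_of_split hD hτ h, Nat.cast_succ]
  · rw [← card_loop_insert_of_merge hD hτ h, Nat.cast_succ, add_neg_cancel_right]

theorem siteOp_siteOp_unitChain [Finite X] [Finite C] (hD : D.MergesOrSplits) (hne : σ ≠ τ)
    (hσ : σ ∉ S) (hτ : τ ∉ S) :
    siteOp R S τ (siteOp R (insert τ S) σ (unitChain R D (insert σ (insert τ S)))) =
      siteOp R S σ (siteOp R (insert σ S) τ (unitChain R D (insert σ (insert τ S)))) := by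
  have hσ' : σ ∉ insert τ S := by simp [hσ, hne]
  have hτ' : τ ∉ insert σ S := by simp [hτ, hne.symm]
  have comm : insert τ (insert σ S) = insert σ (insert τ S) := Finset.insert_comm ..
  have card_eq : Nat.card (D.Loop (insert σ (insert τ S))) =
      Nat.card (D.Loop (insert τ (insert σ S))) := by rw [comm]
  have touching_iff := comm ▸ hD (insert σ S) τ hτ'
  zify at card_eq
  rw [card_loop_insert hD hσ', card_loop_insert hD hτ, card_loop_insert hD hτ',
    card_loop_insert hD hσ] at card_eq
  by_cases h₁ : D.SelfTouching S τ <;> by_cases h₂ : D.SelfTouching (insert τ S) σ <;>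
    by_cases h₃ : D.SelfTouching S σ <;> by_cases h₄ : D.SelfTouching (insert σ S) τ <;>
    simp only [h₁, h₂, h₃, h₄, if_true, if_false] at card_eq <;> try omega
  all_goals simp only [siteOp, h₁, h₂, h₃, h₄, if_true, if_false, Module.End.one_apply]
  · have commute : Commute (mulComul (D := D) R τ) (mulComul R σ) :=
      commute_mulComul (fun p => (commute_mulComul (commute_mulX p) τ).symm) σ
    exact LinearMap.congr_fun commute.eq _
  · exact (mulComul_unitChain_congr <|
      strandLoops_insert_insert_of_split_merge hD hσ' h₁ h₃ h₂ (touching_iff.2 h₄)).symm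
  · exact mulComul_unitChain_congr <|
      strandLoops_insert_insert_of_merge_split hD hτ h₁ h₃ h₂ (touching_iff.not.2 (not_not.2 h₄))

variable [Fintype X] [Finite C]

open Classical in
variable (R) in
/-- The partial differential at a site, without sign. -/
noncomputable def partialDiff (τ : X) : Module.End R (D.Chain R) where
  toFun f s' := ∑ s : D.EnhancedState, if D.IsPartialTerm τ s s' then f s else 0
  map_add' f g := by
    funext s'
    simp only [Pi.add_apply, ← Finset.sum_add_distrib]
    exact Finset.sum_congr rfl fun s _ => by split_ifs <;> simp
  map_smul' a f := by
    funext s'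
    simp [Finset.mul_sum]

open Classical in
theorem partialDiff_apply (τ : X) (f : D.Chain R) (s' : D.EnhancedState) :
    partialDiff R τ f s' = ∑ s : D.EnhancedState, if D.IsPartialTerm τ s s' then f s else 0 := rfl

open Classical in
theorem partialDiff_single (τ : X) (s s' : D.EnhancedState) :
    partialDiff R τ (Pi.single s 1) s' = if D.IsPartialTerm τ s s' then 1 else 0 := by
  rw [partialDiff_apply, Finset.sum_eq_single s]
  · simp
  · intro t _ ht
    simp [Pi.single_eq_of_ne ht]
  · simp

theorem commute_partialDiff_mulX (hD : D.MergesOrSplits) (τ : X) (p : Point X C) :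
    Commute (partialDiff R τ) (mulX (D := D) R p) := by
  classical
  refine LinearMap.pi_ext' fun s => LinearMap.ext_ring (funext fun s' => ?_)
  simp only [LinearMap.comp_apply, LinearMap.single_apply, Module.End.mul_apply]
  rw [mulX_apply, partialDiff_single, ← ite_and]
  cases hp : s.label p with
  | one => simp only [mulX_single hp, partialDiff_single, isPartialTerm_setLabel_X_iff hD hp]
  | X =>
    rw [mulX_single_eq_zero hp, map_zero, if_neg, Pi.zero_apply]
    rintro ⟨-, h⟩
    have hX := label_eq_X_of_isPartialTerm hD h hp
    rw [label_setLabel_self] at hX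
    cases hX

theorem partialDiff_unitChain_of_mem (h : τ ∈ S) : partialDiff R τ (unitChain R D S) = 0 := by
  classical
  funext s'
  rw [unitChain, partialDiff_single, if_neg fun k => k.1 h, Pi.zero_apply]

theorem partialDiff_unitChain (hD : D.MergesOrSplits) (hτ : τ ∉ S) :
    partialDiff R τ (unitChain R D S) = siteOp R S τ (unitChain R D (insert τ S)) := by
  classical
  funext s'
  rw [unitChain, unitChain, partialDiff_single]
  by_cases h : D.SelfTouching S τ
  · have hne : (allOne D (insert τ S)).setLabel (firstStrand τ) .X ≠
        (allOne D (insert τ S)).setLabel (secondStrand τ) .X := by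
      have h' := selfTouching_iff_loopOf_eq.not.1 (not_selfTouching_insert hD hτ h)
      intro k
      have := congrArg (fun s => s.label (firstStrand τ)) k
      simp [label_setLabel, h'] at this
    rw [siteOp, if_pos h, mulComul_apply, mulX_single rfl, mulX_single rfl,
      Pi.add_apply, Pi.single_apply, Pi.single_apply, isPartialTerm_allOne_iff_of_split hD hτ h]
    split_ifs <;> grind
  · rw [siteOp, if_neg h, Module.End.one_apply, Pi.single_apply,
      isPartialTerm_allOne_iff_of_merge hD hτ h]

theorem partialDiff_partialDiff_unitChain (hD : D.MergesOrSplits) (σ : X) (hτ : τ ∉ S) :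
    partialDiff R σ (partialDiff R τ (unitChain R D S)) =
      siteOp R S τ (partialDiff R σ (unitChain R D (insert τ S))) := by
  rw [partialDiff_unitChain hD hτ, ← Module.End.mul_apply,
    (commute_siteOp (commute_partialDiff_mulX hD σ) S τ).eq, Module.End.mul_apply]

theorem commute_partialDiff (hD : D.MergesOrSplits) (σ τ : X) :
    Commute (partialDiff R σ) (partialDiff (D := D) R τ) := by
  have commute_mulX (ω ω' : X) (p : Point X C) :
      Commute (partialDiff R ω * partialDiff R ω') (mulX (D := D) R p) :=
    (commute_partialDiff_mulX hD ω p).mul_left (commute_partialDiff_mulX hD ω' p)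
  refine End_ext_of_commute_mulX (commute_mulX σ τ) (commute_mulX τ σ) fun S => ?_
  rw [Module.End.mul_apply, Module.End.mul_apply]
  rcases eq_or_ne σ τ with rfl | hne
  · rfl
  by_cases hτ : τ ∈ S <;> by_cases hσ : σ ∈ S
  · rw [partialDiff_unitChain_of_mem hτ, partialDiff_unitChain_of_mem hσ, map_zero, map_zero]
  · rw [partialDiff_partialDiff_unitChain hD τ hσ, partialDiff_unitChain_of_mem hτ,
      partialDiff_unitChain_of_mem (Finset.mem_insert_of_mem hτ), map_zero, map_zero]
  · rw [partialDiff_partialDiff_unitChain hD σ hτ, partialDiff_unitChain_of_mem hσ,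
      partialDiff_unitChain_of_mem (Finset.mem_insert_of_mem hσ), map_zero, map_zero]
  · rw [partialDiff_partialDiff_unitChain hD τ hσ, partialDiff_partialDiff_unitChain hD σ hτ,
      partialDiff_unitChain hD (by simp [hσ, hne]),
      partialDiff_unitChain hD (by simp [hτ, hne.symm]),
      Finset.insert_comm τ σ S, siteOp_siteOp_unitChain hD hne hσ hτ]

end Operators

end LinkDiagram

/-! ### The differential -/

theorem sum_mul_self_eq_zero_of_anticommute {ι A : Type*} [NonUnitalNonAssocRing A] (s : Finset ι)
    {a : ι → A} (sq : ∀ i ∈ s, a i * a i = 0)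
    (anticomm : (s : Set ι).Pairwise fun i j => a i * a j = -(a j * a i)) :
    (∑ i ∈ s, a i) * ∑ i ∈ s, a i = 0 := by
  classical
  induction s using Finset.induction_on with
  | empty => simp
  | insert i s hi ih =>
    rw [Finset.coe_insert, Set.pairwise_insert_of_notMem (by simpa using hi)] at anticomm
    have mul_sum_eq : a i * ∑ j ∈ s, a j = -((∑ j ∈ s, a j) * a i) := by
      rw [Finset.mul_sum, Finset.sum_mul, ← Finset.sum_neg_distrib]
      exact Finset.sum_congr rfl fun j hj => (anticomm.2 j hj).1
    rw [Finset.sum_insert hi, add_mul, mul_add, mul_add, sq i (Finset.mem_insert_self i s),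
      ih (fun j hj => sq j (Finset.mem_insert_of_mem hj)) anticomm.1, mul_sum_eq]
    abel

namespace LinkDiagram

section Differential

variable {X C : Type*} [LinearOrder X] {R : Type*} [CommRing R] {D : LinkDiagram X C}

variable (R) in
/-- The diagonal operator of the signs `(-1)^k` of a site, where `k` is the number of `B`-sites
before it. -/
def siteSign (τ : X) : Module.End R (D.Chain R) where
  toFun f s := (-1) ^ (s.1.filter fun σ => σ < τ).card * f s
  map_add' f g := by
    funext s
    simp [mul_add]
  map_smul' a f := by
    funext s
    simp [mul_left_comm]

theorem siteSign_apply (τ : X) (f : D.Chain R) (s : D.EnhancedState) :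
    siteSign R τ f s = (-1) ^ (s.1.filter fun σ => σ < τ).card * f s := rfl

theorem commute_siteSign (σ τ : X) : Commute (siteSign R σ) (siteSign (D := D) R τ) :=
  LinearMap.ext fun f => funext fun s => by
    simp only [Module.End.mul_apply, siteSign_apply, mul_left_comm]

variable [Fintype X] [Finite C]

theorem siteSign_mul_partialDiff (σ τ : X) : siteSign R σ * partialDiff (D := D) R τ =
    (if τ < σ then -1 else 1 : ℤ) • (partialDiff R τ * siteSign R σ) := by
  classical
  refine LinearMap.ext fun f => funext fun s' => ?_
  rw [Module.End.mul_apply, siteSign_apply, LinearMap.smul_apply, Pi.smul_apply,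
    Module.End.mul_apply, partialDiff_apply, partialDiff_apply, Finset.mul_sum, Finset.smul_sum]
  refine Finset.sum_congr rfl fun s _ => ?_
  split_ifs with h hlt
  · rw [siteSign_apply, h.2.1, Finset.filter_insert, if_pos hlt,
      Finset.card_insert_of_notMem fun k => h.1 (Finset.mem_filter.1 k).1, pow_succ,
      neg_one_zsmul]
    ring
  · rw [siteSign_apply, h.2.1, Finset.filter_insert, if_neg hlt, one_zsmul]
  all_goals rw [mul_zero, smul_zero]

theorem partialDiff_mul_self (τ : X) : partialDiff R τ * partialDiff (D := D) R τ = 0 := by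
  classical
  refine LinearMap.ext fun f => funext fun s' => ?_
  rw [Module.End.mul_apply, partialDiff_apply]
  refine Finset.sum_eq_zero fun s _ => ite_eq_right_iff.2 fun h => ?_
  refine Finset.sum_eq_zero fun t _ => if_neg fun k => h.1 ?_
  rw [k.2.1]
  exact Finset.mem_insert_self τ t.1

theorem differential_eq_sum : D.differential R = ∑ τ : X, partialDiff R τ * siteSign R τ := by
  classical
  refine LinearMap.ext fun f => funext fun s' => ?_
  simp only [LinearMap.sum_apply, Finset.sum_apply, Module.End.mul_apply, partialDiff_apply,
    siteSign_apply]
  rw [Finset.sum_comm]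
  refine Finset.sum_congr rfl fun s _ => ?_
  rw [incidence, Finset.mul_sum]
  exact Finset.sum_congr rfl fun τ _ => by rw [mul_ite, mul_zero, mul_comm (f s)]

theorem partialDiff_siteSign_mul (σ τ : X) :
    partialDiff R σ * siteSign R σ * (partialDiff R τ * siteSign (D := D) R τ) =
      (if τ < σ then -1 else 1 : ℤ) •
        (partialDiff R σ * partialDiff R τ * (siteSign R σ * siteSign R τ)) := by
  rw [mul_assoc, ← mul_assoc (siteSign R σ), siteSign_mul_partialDiff, smul_mul_assoc,
    mul_smul_comm, mul_assoc, mul_assoc]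

theorem differential_comp_self (hD : D.MergesOrSplits) :
    D.differential R ∘ₗ D.differential R = 0 := by
  rw [differential_eq_sum, ← Module.End.mul_eq_comp]
  refine sum_mul_self_eq_zero_of_anticommute _ (fun τ _ => ?_) fun σ _ τ _ hne => ?_
  · rw [partialDiff_siteSign_mul, partialDiff_mul_self, zero_mul, smul_zero]
  · beta_reduce
    rw [partialDiff_siteSign_mul, partialDiff_siteSign_mul, (commute_partialDiff hD σ τ).eq,
      (commute_siteSign σ τ).eq]
    rcases hne.lt_or_gt with h | h
    · rw [if_neg h.not_gt, if_pos h, one_zsmul, neg_one_zsmul, neg_neg]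
    · rw [if_pos h, if_neg h.not_gt, one_zsmul, neg_one_zsmul]

theorem map_chainGroup_le (hD : D.MergesOrSplits) (i j : ℤ) :
    (D.chainGroup R i j).map (D.differential R) ≤ D.chainGroup R (i + 1) j := by
  rintro _ ⟨f, hf, rfl⟩ s' hs'
  refine Finset.sum_eq_zero fun s _ => ?_
  by_cases hs : (s.nB : ℤ) = i ∧ s.jdeg = j
  · rw [incidence, Finset.sum_eq_zero, mul_zero]
    refine fun τ _ => if_neg fun h => hs' ⟨?_, ?_⟩
    · rw [nB_of_isPartialTerm h, ← hs.1, Nat.cast_succ]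
    · rw [jdeg_of_isPartialTerm hD h, hs.2]
  · rw [hf s hs, zero_mul]

end Differential

end LinkDiagram

/-! ### Ranks of the chain groups -/

theorem zpow_sum₀ {ι K : Type*} [CommGroupWithZero K] {q : K} (hq : q ≠ 0) (s : Finset ι)
    (f : ι → ℤ) : q ^ ∑ i ∈ s, f i = ∏ i ∈ s, q ^ f i := by
  classical
  induction s using Finset.induction_on with
  | empty => simp
  | insert i s hi ih => rw [Finset.sum_insert hi, Finset.prod_insert hi, zpow_add₀ hq, ih]

namespace LinkDiagram

open EnhancedState

section Ranks

variable {X C : Type*} [LinearOrder X] {R : Type*} [CommRing R] {D : LinkDiagram X C}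

variable (R D) in
theorem chainGroup_eq_iInf_ker_proj (i j : ℤ) :
    D.chainGroup R i j = ⨅ s ∈ {s : D.EnhancedState | (s.nB : ℤ) = i ∧ s.jdeg = j}ᶜ,
      LinearMap.ker (LinearMap.proj s) := by
  ext f
  simp only [Submodule.mem_iInf]
  rfl

open Classical in
theorem finrank_chainGroup [Fintype D.EnhancedState] [Nontrivial R] (i j : ℤ) :
    Module.finrank R (D.chainGroup R i j) =
      (Finset.univ.filter fun s : D.EnhancedState => (s.nB : ℤ) = i ∧ s.jdeg = j).card := by
  rw [chainGroup_eq_iInf_ker_proj, (LinearMap.iInfKerProjEquiv R _ disjoint_compl_right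
    (Set.union_compl_self _).ge).finrank_eq, Module.finrank_fintype_fun_eq_card]
  exact Fintype.card_subtype _

variable [Fintype X]

theorem EnhancedState.nB_lt (s : D.EnhancedState) : s.nB < Fintype.card X + 1 :=
  Nat.lt_succ_of_le (Finset.card_le_univ s.1)

variable [Finite C]

open Classical in
variable (R) in
theorem chiRho_eq_sum [Nontrivial R] (ρ : ℂ) (j : ℤ) : D.chiRho R ρ j =
    ∑ s : D.EnhancedState, if s.jdeg = j then (-ρ) ^ s.nB else 0 := by
  simp only [chiRho, finrank_chainGroup, Finset.card_filter, Nat.cast_sum, Finset.mul_sum]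
  rw [Finset.sum_comm]
  refine Finset.sum_congr rfl fun s _ => ?_
  rw [Finset.sum_eq_single_of_mem s.nB (Finset.mem_range.2 s.nB_lt)]
  · simp only [true_and, Nat.cast_ite, Nat.cast_one, Nat.cast_zero, mul_ite, mul_one, mul_zero]
  · intro i _ hi
    simp [hi.symm]

variable (R) in
theorem support_chiRho_subset_range_jdeg [Nontrivial R] (ρ : ℂ) :
    Function.support (D.chiRho R ρ) ⊆ Set.range (jdeg : D.EnhancedState → ℤ) := by
  intro j hj
  rw [Function.mem_support, chiRho_eq_sum] at hj
  obtain ⟨s, -, hs⟩ := Finset.exists_ne_zero_of_sum_ne_zero hj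
  exact ⟨s, (ite_ne_right_iff.1 hs).1⟩

variable (R D) in
theorem finite_support_chiRho [Nontrivial R] (ρ : ℂ) : (Function.support (D.chiRho R ρ)).Finite :=
  (Set.finite_range _).subset (support_chiRho_subset_range_jdeg R ρ)

variable (R) in
theorem finsum_chiRho [Nontrivial R] (q ρ : ℂ) : ∑ᶠ j : ℤ, q ^ j * D.chiRho R ρ j =
    ∑ s : D.EnhancedState, (-ρ) ^ s.nB * q ^ s.jdeg := by
  classical
  have support_subset : Function.support (fun j : ℤ => q ^ j * D.chiRho R ρ j) ⊆
      (Finset.univ.image fun s : D.EnhancedState => s.jdeg : Finset ℤ) := by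
    rw [Finset.coe_image, Finset.coe_univ, Set.image_univ]
    exact (Function.support_mul_subset_right _ _).trans (support_chiRho_subset_range_jdeg R ρ)
  rw [finsum_eq_sum_of_support_subset _ support_subset]
  simp only [chiRho_eq_sum, Finset.mul_sum]
  rw [Finset.sum_comm]
  refine Finset.sum_congr rfl fun s _ => ?_
  simp only [mul_ite, mul_zero, Finset.sum_ite_eq]
  rw [if_pos (Finset.mem_image_of_mem _ (Finset.mem_univ s)), mul_comm]

end Ranks

/-! ### Expansion of the `ρ`-bracket -/

section Expansion

variable {X C : Type*} [DecidableEq X] [Finite C] {D : LinkDiagram X C}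

theorem sum_zpow_lam [Finite X] (S : Finset X) [Fintype (D.Loop S → LoopLabel)] {q : ℂ}
    (hq : q ≠ 0) :
    ∑ a : D.Loop S → LoopLabel, q ^ lam (⟨S, a⟩ : D.EnhancedState) =
      (q + q⁻¹) ^ Nat.card (D.Loop S) := by
  classical
  have : Fintype (D.Loop S) := Fintype.ofFinite _
  have sum_zpow_degree : ∑ x : LoopLabel, q ^ x.degree = q + q⁻¹ := by
    simp [Finset.univ, Fintype.elems, LoopLabel.degree]
  simp only [lam_mk, zpow_sum₀ hq]
  rw [← sum_zpow_degree, Nat.card_eq_fintype_card, ← Finset.card_univ, ← Finset.prod_const,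
    ← Finset.sum_prod_piFinset, Fintype.piFinset_univ]
  exact Finset.sum_congr (by ext; simp) fun _ _ => rfl

theorem sum_enhancedState [Fintype X] {M : Type*} [AddCommMonoid M]
    [∀ S, Fintype (D.Loop S → LoopLabel)] (F : D.EnhancedState → M) :
    ∑ s, F s = ∑ S : Finset X, ∑ a : D.Loop S → LoopLabel, F ⟨S, a⟩ := by
  let toSigma : D.EnhancedState ≃ Σ S : Finset X, (D.Loop S → LoopLabel) := Equiv.refl _
  rw [Fintype.sum_equiv toSigma F F fun _ => rfl]
  exact Fintype.sum_sigma _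

theorem rhoBracket_eq_sum [Fintype X] {q : ℂ} (hq : q ≠ 0) (ρ : ℂ) :
    D.rhoBracket q ρ = ∑ s : D.EnhancedState, (-ρ) ^ s.nB * q ^ s.jdeg := by
  have (S : Finset X) : Fintype (D.Loop S → LoopLabel) := Fintype.ofFinite _
  rw [sum_enhancedState, rhoBracket, bracket]
  refine Finset.sum_congr rfl fun S _ => ?_
  rw [← sum_zpow_lam S hq, Finset.mul_sum]
  refine Finset.sum_congr rfl fun a _ => ?_
  change _ = (-ρ) ^ S.card * q ^ ((S.card : ℤ) + lam (⟨S, a⟩ : D.EnhancedState))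
  rw [zpow_add₀ hq, zpow_natCast, ← mul_assoc, ← mul_pow, neg_mul, mul_comm ρ]

variable (R : Type*) in
theorem rhoBracket_eq_finsum_chiRho {X : Type*} [Fintype X] [LinearOrder X] {D : LinkDiagram X C}
    [CommRing R] [Nontrivial R] {q : ℂ} (hq : q ≠ 0) (ρ : ℂ) :
    D.rhoBracket q ρ = ∑ᶠ j : ℤ, q ^ j * D.chiRho R ρ j := by
  rw [rhoBracket_eq_sum hq, finsum_chiRho]

end Expansion

end LinkDiagram

/-! ### Euler characteristics -/

theorem finrank_quotient_add_finrank_of_rank_lt_aleph0.{u, v} {R : Type u} {M : Type v} [Ring R]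
    [HasRankNullity.{v} R] [AddCommGroup M] [Module R M]
    (h : Module.rank R M < Cardinal.aleph0) (N : Submodule R M) :
    Module.finrank R (M ⧸ N) + Module.finrank R N = Module.finrank R M := by
  have rank_add := HasRankNullity.rank_quotient_add_rank N
  rw [Module.finrank, Module.finrank, Module.finrank, ← rank_add, Cardinal.toNat_add
    ((self_le_add_right _ _).trans_lt (rank_add ▸ h))
    ((self_le_add_left _ _).trans_lt (rank_add ▸ h))]

theorem sum_neg_one_pow_mul_succ_add {A : Type*} [CommRing A] (b : ℤ → A) (n : ℕ) :
    ∑ i ∈ Finset.range n, (-1) ^ i * (b (i + 1) + b i) = b 0 - (-1) ^ n * b n := by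
  induction n with
  | zero => simp
  | succ n ih =>
    rw [Finset.sum_range_succ, ih, pow_succ, Nat.cast_succ]
    ring

namespace LinkDiagram

section EulerCharacteristic

variable {X C : Type*} [Fintype X] [LinearOrder X] {R : Type*} [CommRing R]
  {D : LinkDiagram X C}

theorem chainGroup_eq_bot {i : ℤ} (j : ℤ) (hi : i < 0 ∨ (Fintype.card X : ℤ) < i) :
    D.chainGroup R i j = ⊥ := by
  rw [eq_bot_iff]
  intro f hf
  refine funext fun s => hf s fun h => ?_
  have := s.nB_lt
  omega

variable [Finite C]

theorem boundaries_le_cycles (hD : D.MergesOrSplits) (i j : ℤ) :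
    D.boundaries R i j ≤ D.cycles R i j := by
  refine le_inf ?_ ?_
  · have := map_chainGroup_le (R := R) hD (i - 1) j
    rwa [sub_add_cancel] at this
  · rintro _ ⟨f, -, rfl⟩
    exact LinearMap.congr_fun (differential_comp_self hD) f

theorem boundaries_zero (j : ℤ) : D.boundaries R 0 j = ⊥ := by
  rw [boundaries, chainGroup_eq_bot j (Or.inl (by simp)), Submodule.map_bot]

theorem boundaries_card_add_one (hD : D.MergesOrSplits) (j : ℤ) :
    D.boundaries R (Fintype.card X + 1) j = ⊥ := by
  rw [eq_bot_iff, ← chainGroup_eq_bot j (Or.inr (lt_add_one (Fintype.card X : ℤ)))]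
  exact (boundaries_le_cycles hD _ j).trans inf_le_left

variable [IsDomain R]

variable (R D) in
theorem finrank_cycles_add_finrank_boundaries (i j : ℤ) :
    Module.finrank R (D.cycles R i j) + Module.finrank R (D.boundaries R (i + 1) j) =
      Module.finrank R (D.chainGroup R i j) := by
  set d := (D.differential R).domRestrict (D.chainGroup R i j)
  have finrank_range : Module.finrank R (D.boundaries R (i + 1) j) =
      Module.finrank R (D.chainGroup R i j ⧸ LinearMap.ker d) := by
    rw [LinearEquiv.finrank_eq d.quotKerEquivRange, LinearMap.range_domRestrict, boundaries,
      add_sub_cancel_right]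
  have cycles_eq : D.cycles R i j = (LinearMap.ker d).map (D.chainGroup R i j).subtype := by
    rw [LinearMap.ker_domRestrict, Submodule.map_comap_subtype, cycles]
  have finrank_ker : Module.finrank R (D.cycles R i j) = Module.finrank R (LinearMap.ker d) := by
    rw [cycles_eq, ((D.chainGroup R i j).equivSubtypeMap _).finrank_eq]
  have rank_lt : Module.rank R (D.chainGroup R i j) < Cardinal.aleph0 :=
    (Submodule.rank_le _).trans_lt (Module.rank_lt_aleph0 R (D.Chain R))
  rw [finrank_ker, finrank_range, add_comm, finrank_quotient_add_finrank_of_rank_lt_aleph0 rank_lt]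

theorem finrank_homology_add_finrank_boundaries (hD : D.MergesOrSplits) (i j : ℤ) :
    Module.finrank R (D.Homology R i j) + Module.finrank R (D.boundaries R i j) =
      Module.finrank R (D.cycles R i j) := by
  have rank_lt : Module.rank R (D.cycles R i j) < Cardinal.aleph0 :=
    (Submodule.rank_le _).trans_lt (Module.rank_lt_aleph0 R (D.Chain R))
  rw [← finrank_quotient_add_finrank_of_rank_lt_aleph0 rank_lt,
    (Submodule.submoduleOfEquivOfLe (boundaries_le_cycles hD i j)).finrank_eq]

theorem chiHomology_eq_sum_finrank_chainGroup (hD : D.MergesOrSplits) (j : ℤ) :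
    D.chiHomology R j = ∑ i ∈ Finset.range (Fintype.card X + 1),
      (-1 : ℤ) ^ i * (Module.finrank R (D.chainGroup R (i : ℤ) j) : ℤ) := by
  set b : ℤ → ℤ := fun i => Module.finrank R (D.boundaries R i j) with hb
  have finrank_eq (i : ℕ) : (Module.finrank R (D.chainGroup R (i : ℤ) j) : ℤ) =
      Module.finrank R (D.Homology R (i : ℤ) j) + (b (i + 1) + b i) := by
    rw [hb, ← finrank_cycles_add_finrank_boundaries, ← finrank_homology_add_finrank_boundaries hD]
    push_cast
    ring
  have b_zero : b 0 = 0 := by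
    simp only [hb]
    rw [boundaries_zero, finrank_bot, Nat.cast_zero]
  have b_card_add_one : b (Fintype.card X + 1 : ℕ) = 0 := by
    simp only [hb, Nat.cast_succ]
    rw [boundaries_card_add_one hD, finrank_bot, Nat.cast_zero]
  simp only [finrank_eq, mul_add ((-1 : ℤ) ^ _) (Module.finrank R (D.Homology R _ j) : ℤ),
    Finset.sum_add_distrib, sum_neg_one_pow_mul_succ_add, b_zero, b_card_add_one, mul_zero,
    sub_zero, add_zero, chiHomology]

theorem chiRho_one (hD : D.MergesOrSplits) (j : ℤ) :
    D.chiRho R 1 j = (D.chiHomology R j : ℂ) := by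
  rw [chiHomology_eq_sum_finrank_chainGroup hD, chiRho]
  push_cast
  rfl

end EulerCharacteristic

end LinkDiagram

/-! ### The Potts partition function -/

theorem ne_zero_of_sq_eq_natCast {A : Type*} [Semiring A] [CharZero A] {n : ℕ} (hn : n ≠ 0) {r : A}
    (hr : r ^ 2 = (n : A)) : r ≠ 0 := by
  rintro rfl
  exact Nat.cast_ne_zero.2 hn (hr ▸ zero_pow two_ne_zero)

namespace PlaneGraph

variable {V E : Type*} (G : PlaneGraph V E)

/-- The spin states that agree along the edges in `S`, as functions on the components of the
spanning subgraph with edge set `S`. -/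
def agreeEquiv (S : Finset E) (α : Type*) :
    {σ : V → α // ∀ e ∈ S, σ (G.vert (e, false)) = σ (G.vert (e, true))} ≃
      (Quotient (G.component S) → α) where
  toFun σ := Quotient.lift σ.1 fun _ _ h => G.component_le (t := Setoid.ker σ.1) σ.2 h
  invFun f := ⟨fun x => f (Quotient.mk _ x), fun _ he =>
    congrArg f (Quotient.sound (G.component_edge he))⟩
  left_inv _ := rfl
  right_inv _ := funext <| Quotient.ind fun _ => rfl

theorem card_agree [Fintype V] [DecidableEq V] (S : Finset E) (Q : ℕ)
    [DecidablePred fun σ : V → Fin Q =>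
      ∀ e ∈ S, σ (G.vert (e, false)) = σ (G.vert (e, true))] :
    (Finset.univ.filter fun σ : V → Fin Q =>
      ∀ e ∈ S, σ (G.vert (e, false)) = σ (G.vert (e, true))).card =
      Q ^ Nat.card (Quotient (G.component S)) := by
  rw [← Fintype.card_subtype, ← Nat.card_eq_fintype_card, Nat.card_congr (G.agreeEquiv S (Fin Q)),
    Nat.card_fun, Nat.card_fin]

variable [Fintype E] {A : Type*} [CommRing A] {Q : ℕ}

theorem pow_energy_eq_sum (σ : V → Fin Q) (x : A) :
    x ^ G.energy σ = ∑ S : Finset E,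
      if ∀ e ∈ S, σ (G.vert (e, false)) = σ (G.vert (e, true)) then (x - 1) ^ S.card else 0 := by
  classical
  calc x ^ G.energy σ
      = ∏ e : E, (1 + if σ (G.vert (e, false)) = σ (G.vert (e, true)) then x - 1 else 0) := by
        rw [energy, ← Finset.prod_const, Finset.prod_filter]
        refine Finset.prod_congr rfl fun e _ => ?_
        split_ifs <;> ring
    _ = ∑ S : Finset E,
        ∏ e ∈ S, if σ (G.vert (e, false)) = σ (G.vert (e, true)) then x - 1 else 0 := by
        rw [Finset.prod_one_add, Finset.powerset_univ]
    _ = _ := Finset.sum_congr rfl fun S _ => by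
        rw [Finset.prod_ite_zero, Finset.prod_const]

variable [Fintype V] [DecidableEq V]

theorem sum_pow_energy (Q : ℕ) (x : A) : ∑ σ : V → Fin Q, x ^ G.energy σ =
    ∑ S : Finset E, (x - 1) ^ S.card * (Q : A) ^ Nat.card (Quotient (G.component S)) := by
  simp only [pow_energy_eq_sum]
  rw [Finset.sum_comm]
  refine Finset.sum_congr rfl fun S _ => ?_
  rw [← Finset.sum_filter, Finset.sum_const, card_agree, nsmul_eq_mul, Nat.cast_pow, mul_comm]

theorem sum_pow_energy_eq_bracket [DecidableEq E] {r : ℂ} (hr : r ^ 2 = (Q : ℂ)) (hr₀ : r ≠ 0)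
    (x : ℂ) : ∑ σ : V → Fin Q, x ^ G.energy σ =
      r ^ Fintype.card V * G.linkDiagram.bracket (r⁻¹ * (x - 1)) r := by
  rw [sum_pow_energy, LinkDiagram.bracket, Finset.mul_sum]
  refine Finset.sum_congr rfl fun S _ => ?_
  have euler : r ^ Nat.card (G.linkDiagram.Loop S) * r ^ Fintype.card V =
      (r ^ 2) ^ Nat.card (Quotient (G.component S)) * r ^ S.card := by
    rw [← pow_add, ← Nat.card_eq_fintype_card, card_loop_add_card, pow_add, pow_mul]
  rw [mul_pow, inv_pow, ← hr]
  field_simp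
  linear_combination (-(x - 1) ^ S.card) * euler

theorem potts_eq_sum_pow_energy (Q : ℕ) (K : ℂ) :
    G.potts Q K = ∑ σ : V → Fin Q, Complex.exp K ^ G.energy σ := by
  refine Finset.sum_congr rfl fun σ _ => ?_
  rw [← Complex.exp_nat_mul, mul_comm]

theorem potts_eq_bracket [DecidableEq E] (hQ : Q ≠ 0) (K : ℂ) {r : ℂ} (hr : r ^ 2 = (Q : ℂ)) :
    G.potts Q K =
      r ^ Fintype.card V * G.linkDiagram.bracket (r⁻¹ * (Complex.exp K - 1)) r := by
  rw [potts_eq_sum_pow_energy,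
    G.sum_pow_energy_eq_bracket hr (ne_zero_of_sq_eq_natCast hQ hr)]

end PlaneGraph

theorem LinkDiagram.bracket_one {X C : Type*} [Fintype X] [DecidableEq X] (D : LinkDiagram X C)
    (b : ℂ) : D.bracket b 1 = (1 + b) ^ Fintype.card X := by
  simp only [bracket, one_pow, mul_one]
  rw [← Finset.card_univ, ← Finset.prod_const, Finset.prod_one_add, Finset.powerset_univ]
  simp only [Finset.prod_const]

/-! ### Recovering `ρ = 1` from the `ρ`-bracket -/

namespace LinkDiagram

variable {X C : Type*} [Fintype X] [DecidableEq X] {D : LinkDiagram X C}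

theorem rhoBracket_of_add_inv_eq_one {q : ℂ} (hq : q + q⁻¹ = 1) (ρ : ℂ) :
    D.rhoBracket q ρ = (1 - q * ρ) ^ Fintype.card X := by
  rw [rhoBracket, hq, bracket_one, sub_eq_add_neg]

variable [Nonempty X] {ρ : ℂ}

theorem norm_one_sub_mul_eq_of_rhoBracket_eq {q : ℂ} (hq : q + q⁻¹ = 1)
    (h : D.rhoBracket q ρ = D.rhoBracket q 1) : ‖1 - q * ρ‖ = ‖1 - q‖ := by
  rw [rhoBracket_of_add_inv_eq_one hq, rhoBracket_of_add_inv_eq_one hq, mul_one] at h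
  refine (pow_left_inj₀ (norm_nonneg _) (norm_nonneg _) (Fintype.card_ne_zero (α := X))).1 ?_
  rw [← norm_pow, h, norm_pow]

theorem normSq_eq_of_rhoBracket_eq {t : ℝ} (ht : t ^ 2 = 3)
    (h : D.rhoBracket ⟨1 / 2, t / 2⟩ ρ = D.rhoBracket ⟨1 / 2, t / 2⟩ 1) :
    Complex.normSq ρ = ρ.re - t * ρ.im := by
  set q : ℂ := ⟨1 / 2, t / 2⟩ with hq
  have normSq_q : Complex.normSq q = 1 := by
    rw [hq, Complex.normSq_mk]
    linear_combination ht / 4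
  have q_add_inv : q + q⁻¹ = 1 := by
    rw [Complex.inv_def, normSq_q, inv_one, Complex.ofReal_one, mul_one, Complex.add_conj]
    norm_num
  have normSq_eq : Complex.normSq (1 - q * ρ) = Complex.normSq (1 - q) := by
    rw [Complex.normSq_eq_norm_sq, Complex.normSq_eq_norm_sq,
      norm_one_sub_mul_eq_of_rhoBracket_eq q_add_inv h]
  simp only [Complex.normSq_sub, map_one, normSq_q, map_mul, one_mul, Complex.conj_re] at normSq_eq
  simp only [Complex.mul_re, Complex.conj_re, Complex.conj_im, hq] at normSq_eq
  linear_combination normSq_eq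

/-- At the primitive sixth roots of unity the loop value is `1`, so the `ρ`-bracket is the power
`(1 - q * ρ) ^ card X`, and its norm puts `ρ` at distance `1` from both of these roots. -/
theorem eq_zero_or_eq_one_of_rhoBracket_eq
    (h : ∀ q : ℂ, q ≠ 0 → D.rhoBracket q ρ = D.rhoBracket q 1) : ρ = 0 ∨ ρ = 1 := by
  have sq_sqrt : √3 ^ 2 = (3 : ℝ) := Real.sq_sqrt (by norm_num)
  have ne_zero (t : ℝ) : (⟨1 / 2, t / 2⟩ : ℂ) ≠ 0 := fun h => by
    simpa using congrArg Complex.re h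
  have normSq_eq := normSq_eq_of_rhoBracket_eq sq_sqrt (h _ (ne_zero _))
  have normSq_eq' := normSq_eq_of_rhoBracket_eq (by rw [neg_sq, sq_sqrt]) (h _ (ne_zero (-√3)))
  have im_eq_zero : ρ.im = 0 :=
    (mul_eq_zero.1 (show √3 * ρ.im = 0 by linarith)).resolve_left (by norm_num)
  have re_mul_self : ρ.re * ρ.re = ρ.re := by
    rw [Complex.normSq_apply, im_eq_zero] at normSq_eq
    linear_combination normSq_eq
  rcases IsIdempotentElem.iff_eq_zero_or_one.1 re_mul_self with re_eq | re_eq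
  exacts [Or.inl (Complex.ext re_eq im_eq_zero), Or.inr (Complex.ext re_eq im_eq_zero)]

end LinkDiagram

theorem inv_mul_neg_sq_sub_one {A : Type*} [Field A] {q : A} (hq : q ≠ 0) (hr : q + q⁻¹ ≠ 0) :
    (q + q⁻¹)⁻¹ * (-q ^ 2 - 1) = -q := by
  rw [inv_mul_eq_iff_eq_mul₀ hr]
  field_simp
  ring

namespace PlaneGraph

variable {V E : Type*} [Fintype E] (G : PlaneGraph V E) {Q : ℕ}

theorem sum_pow_energy_lt [Fintype V] [DecidableEq V] [Nonempty E] (hQ : Q ≠ 0) {x : ℝ}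
    (hx : |x| < 1) :
    ∑ σ : V → Fin Q, x ^ G.energy σ < (Q : ℝ) ^ Fintype.card V := by
  have : NeZero Q := ⟨hQ⟩
  have pow_le (n : ℕ) : x ^ n ≤ |x| ^ n := (le_abs_self _).trans (abs_pow x n).le
  calc ∑ σ : V → Fin Q, x ^ G.energy σ
      < ∑ _σ : V → Fin Q, (1 : ℝ) := by
        refine Finset.sum_lt_sum
          (fun σ _ => (pow_le _).trans (pow_le_one₀ (abs_nonneg _) hx.le))
          ⟨fun _ => 0, Finset.mem_univ _,
            (pow_le _).trans_lt (pow_lt_one₀ (abs_nonneg _) hx ?_)⟩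
        simp [energy]
    _ = (Q : ℝ) ^ Fintype.card V := by simp

variable [DecidableEq E]

theorem rhoBracket_zero_ne_rhoBracket_one [Finite V] [Nonempty E] {q : ℝ} (hq : q ≠ 0)
    (hq₁ : |q| < 1) (hQ : Q ≠ 0) (hr : (q + q⁻¹) ^ 2 = Q) :
    G.linkDiagram.rhoBracket q 0 ≠ G.linkDiagram.rhoBracket q 1 := by
  have := Fintype.ofFinite V
  classical
  intro h
  have hqC : (q : ℂ) ≠ 0 := Complex.ofReal_ne_zero.2 hq
  have hrC : ((q : ℂ) + (q : ℂ)⁻¹) ^ 2 = (Q : ℂ) := by exact_mod_cast hr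
  have hr₀ : (q : ℂ) + (q : ℂ)⁻¹ ≠ 0 := ne_zero_of_sq_eq_natCast hQ hrC
  have sum_eq := G.sum_pow_energy_eq_bracket hrC hr₀ (-(q : ℂ) ^ 2)
  have sum_one_eq := G.sum_pow_energy_eq_bracket hrC hr₀ 1
  rw [LinkDiagram.rhoBracket, LinkDiagram.rhoBracket, mul_zero, neg_zero, mul_one] at h
  rw [inv_mul_neg_sq_sub_one hqC hr₀, ← h] at sum_eq
  rw [sub_self, mul_zero, ← sum_eq] at sum_one_eq
  have abs_lt : |-q ^ 2| < 1 := by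
    rw [abs_neg, abs_pow]
    exact pow_lt_one₀ (abs_nonneg q) hq₁ two_ne_zero
  refine (G.sum_pow_energy_lt hQ abs_lt).ne ?_
  have : ((∑ σ : V → Fin Q, (-q ^ 2) ^ G.energy σ : ℝ) : ℂ) = (Q : ℂ) ^ Fintype.card V := by
    push_cast
    rw [← sum_one_eq]
    simp
  exact_mod_cast this

/-- Taking for `q` the conjugate of the golden ratio makes the loop value a square root of `5` and
`e ^ K = -q ^ 2` of modulus less than `1`; this rules out `ρ = 0`, where `e ^ K = 1`. -/
theorem eq_one_of_rhoBracket_eq [Finite V] [Nonempty E] {ρ : ℂ}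
    (h : ∀ q : ℂ, q ≠ 0 → G.linkDiagram.rhoBracket q ρ = G.linkDiagram.rhoBracket q 1) :
    ρ = 1 := by
  refine (LinkDiagram.eq_zero_or_eq_one_of_rhoBracket_eq h).resolve_left ?_
  rintro rfl
  refine G.rhoBracket_zero_ne_rhoBracket_one (q := Real.goldenConj) (Q := 5)
    Real.goldenConj_ne_zero ?_ (by norm_num) ?_ (h _ ?_)
  · exact abs_lt.2 ⟨Real.neg_one_lt_goldenConj, Real.goldenConj_neg.trans one_pos⟩
  · rw [Real.inv_goldenConj, ← sub_eq_add_neg, sub_sq_comm, Real.goldenRatio_sub_goldenConj,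
      Real.sq_sqrt (by norm_num), Nat.cast_ofNat]
  · exact Complex.ofReal_ne_zero.2 Real.goldenConj_ne_zero

end PlaneGraph

theorem PlaneGraph.chiRho_eq_chiHomology_iff {V E R : Type*} [Finite V]
    [Fintype E] [LinearOrder E] [Nonempty E] (G : PlaneGraph V E) [CommRing R] [IsDomain R]
    {ρ : ℂ} :
    (∀ j, G.linkDiagram.chiRho R ρ j = (G.linkDiagram.chiHomology R j : ℂ)) ↔ ρ = 1 := by
  constructor
  · intro h
    refine G.eq_one_of_rhoBracket_eq fun q hq => ?_
    simp only [LinkDiagram.rhoBracket_eq_finsum_chiRho R hq, h,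
      LinkDiagram.chiRho_one G.mergesOrSplits]
  · rintro rfl
    exact LinkDiagram.chiRho_one G.mergesOrSplits

/-! ### The change of variables -/

section IsPottsParam

variable {Q : ℕ} {K r q ρ : ℂ}

theorem half_add_ne_zero_and_inv_eq {w : ℂ} (h : r ^ 2 - w ^ 2 = 4) :
    (r + w) / 2 ≠ 0 ∧ ((r + w) / 2)⁻¹ = (r - w) / 2 := by
  have mul_eq_one : (r + w) / 2 * ((r - w) / 2) = 1 := by linear_combination h / 4
  exact ⟨left_ne_zero_of_mul_eq_one mul_eq_one, inv_eq_of_mul_eq_one_right mul_eq_one⟩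

theorem exists_isPottsParam (K : ℂ) (hr : r ^ 2 = (Q : ℂ)) :
    ∃ q ρ, IsPottsParam Q K r q ρ := by
  obtain ⟨w, hw⟩ := IsAlgClosed.exists_pow_nat_eq ((Q : ℂ) - 4) two_pos
  obtain ⟨hq, q_inv⟩ := half_add_ne_zero_and_inv_eq (r := r) (w := w) (by rw [hr, hw]; ring)
  refine ⟨(r + w) / 2, -(r⁻¹ * (Complex.exp K - 1)) / ((r + w) / 2), hr, hq, ?_, ?_⟩
  · rw [q_inv]
    ring
  · rw [mul_div_cancel₀ _ hq, neg_neg]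

theorem isPottsParam_one_iff (hQ : Q ≠ 0) : IsPottsParam Q K r q 1 ↔
    r ^ 2 = (Q : ℂ) ∧ q ≠ 0 ∧ q + q⁻¹ = r ∧ Complex.exp K = -q ^ 2 := by
  suffices site_value_iff : r ^ 2 = (Q : ℂ) → q ≠ 0 → q + q⁻¹ = r →
      (-(q * 1) = r⁻¹ * (Complex.exp K - 1) ↔ Complex.exp K = -q ^ 2) from
    ⟨fun ⟨hr, hq, hqr, hK⟩ => ⟨hr, hq, hqr, (site_value_iff hr hq hqr).1 hK⟩,
      fun ⟨hr, hq, hqr, hK⟩ => ⟨hr, hq, hqr, (site_value_iff hr hq hqr).2 hK⟩⟩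
  rintro hr hq rfl
  have hr₀ := ne_zero_of_sq_eq_natCast hQ hr
  rw [mul_one, ← inv_mul_neg_sq_sub_one hq hr₀, mul_right_inj' (inv_ne_zero hr₀), sub_left_inj,
    eq_comm]

theorem exists_isPottsParam_one_iff (hQ : Q ≠ 0) : (∃ r q, IsPottsParam Q K r q 1) ↔
    ∃ r w : ℂ, r ^ 2 = (Q : ℂ) ∧ w ^ 2 = (Q : ℂ) - 4 ∧
      Complex.exp K = (2 - (Q : ℂ) - r * w) / 2 := by
  simp only [isPottsParam_one_iff hQ]
  constructor
  · rintro ⟨_, q, hr, hq, rfl, hK⟩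
    have mul_inv := mul_inv_cancel₀ hq
    refine ⟨q + q⁻¹, q - q⁻¹, hr, ?_, ?_⟩
    · linear_combination hr - 4 * mul_inv
    · linear_combination hK - hr / 2 + mul_inv
  · rintro ⟨r, w, hr, hw, hK⟩
    obtain ⟨hq, q_inv⟩ := half_add_ne_zero_and_inv_eq (r := r) (w := w) (by rw [hr, hw]; ring)
    refine ⟨r, (r + w) / 2, hr, hq, ?_, ?_⟩
    · rw [q_inv]
      ring
    · linear_combination hK + (1 / 4) * hr + hw / 4

theorem exists_isPottsParam_one_iff_of_sq (hQ : Q ≠ 0) {d : ℂ}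
    (hd : d ^ 2 = (Q : ℂ) * ((Q : ℂ) - 4)) :
    (∃ r q, IsPottsParam Q K r q 1) ↔
      Complex.exp K = (2 - (Q : ℂ) + d) / 2 ∨ Complex.exp K = (2 - (Q : ℂ) - d) / 2 := by
  rw [exists_isPottsParam_one_iff hQ]
  constructor
  · rintro ⟨r, w, hr, hw, hK⟩
    have sq_eq : (r * w) ^ 2 = d ^ 2 := by rw [mul_pow, hr, hw, hd]
    rcases sq_eq_sq_iff_eq_or_eq_neg.1 sq_eq with rw_eq | rw_eq
    · exact Or.inr (by rw [hK, rw_eq])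
    · exact Or.inl (by rw [hK, rw_eq, sub_neg_eq_add])
  · intro hK
    obtain ⟨r, hr⟩ := IsAlgClosed.exists_pow_nat_eq (Q : ℂ) two_pos
    have hr₀ := ne_zero_of_sq_eq_natCast hQ hr
    have sq_div : (d / r) ^ 2 = (Q : ℂ) - 4 := by
      rw [div_pow, hd, hr, mul_div_cancel_left₀ _ (Nat.cast_ne_zero.2 hQ)]
    have mul_div := mul_div_cancel₀ d hr₀
    rcases hK with hK | hK
    · exact ⟨r, -(d / r), hr, by rw [neg_sq, sq_div], by linear_combination hK - mul_div / 2⟩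
    · exact ⟨r, d / r, hr, sq_div, by linear_combination hK + mul_div / 2⟩

theorem exists_isPottsParam_two_one_iff : (∃ r q, IsPottsParam 2 K r q 1) ↔
    Complex.exp K = Complex.I ∨ Complex.exp K = -Complex.I := by
  rw [exists_isPottsParam_one_iff_of_sq two_ne_zero (d := 2 * Complex.I)
    (by rw [mul_pow, Complex.I_sq]; norm_num)]
  refine or_congr ?_ ?_ <;> refine Eq.congr rfl ?_ <;> push_cast <;> ring

theorem exists_isPottsParam_three_one_iff : (∃ r q, IsPottsParam 3 K r q 1) ↔
    Complex.exp K = (-1 + (√3 : ℂ) * Complex.I) / 2 ∨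
      Complex.exp K = (-1 - (√3 : ℂ) * Complex.I) / 2 := by
  have sq_sqrt : (√3 : ℂ) ^ 2 = 3 := by
    exact_mod_cast Real.sq_sqrt (show (0 : ℝ) ≤ 3 by norm_num)
  rw [exists_isPottsParam_one_iff_of_sq three_ne_zero (d := (√3 : ℂ) * Complex.I)
    (by rw [mul_pow, Complex.I_sq, sq_sqrt]; norm_num)]
  refine or_congr ?_ ?_ <;> refine Eq.congr rfl ?_ <;> push_cast <;> ring

theorem exists_isPottsParam_four_one_iff :
    (∃ r q, IsPottsParam 4 K r q 1) ↔ Complex.exp K = -1 := by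
  rw [exists_isPottsParam_one_iff_of_sq four_ne_zero (d := 0) (by norm_num), sub_zero, add_zero,
    or_self]
  norm_num

theorem exists_exp_eq_neg_of_isPottsParam_one (hQ : 4 < Q) (h : ∃ r q, IsPottsParam Q K r q 1) :
    ∃ x : ℝ, x < 0 ∧ Complex.exp K = (x : ℂ) := by
  have hQ' : (4 : ℝ) < Q := by exact_mod_cast hQ
  obtain ⟨d, d_nonneg, sq_d⟩ : ∃ d : ℝ, 0 ≤ d ∧ d ^ 2 = Q * (Q - 4) :=
    ⟨√(Q * (Q - 4)), Real.sqrt_nonneg _, Real.sq_sqrt (mul_nonneg (by linarith) (by linarith))⟩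
  have d_lt : d < Q - 2 := by
    refine lt_of_pow_lt_pow_left₀ 2 (by linarith) ?_
    rw [sq_d]
    linarith
  rcases (exists_isPottsParam_one_iff_of_sq (by omega) (d := d) (by exact_mod_cast sq_d)).1 h
    with hK | hK
  · exact ⟨(2 - Q + d) / 2, by linarith, by rw [hK]; push_cast; rfl⟩
  · exact ⟨(2 - Q - d) / 2, by linarith, by rw [hK]; push_cast; rfl⟩

theorem isPottsParam_neg_one_one_iff (hQ : Q ≠ 0) :
    IsPottsParam Q K r (-1) 1 ↔ Q = 4 ∧ Complex.exp K = -1 ∧ r = -2 := by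
  have loop_value : (-1 : ℂ) + (-1)⁻¹ = -2 := by norm_num
  rw [isPottsParam_one_iff hQ, loop_value, neg_one_sq]
  constructor
  · rintro ⟨hr, -, rfl, hK⟩
    exact ⟨by rw [← Nat.cast_inj (R := ℂ), ← hr]; norm_num, hK, rfl⟩
  · rintro ⟨rfl, hK, rfl⟩
    exact ⟨by norm_num, by norm_num, rfl, hK⟩

theorem exists_isPottsParam_critical_iff (hQ : Q ≠ 0) :
    (∃ r q ρ, IsPottsParam Q K r q ρ ∧ -(ρ * q) = 1 ∧ ρ = 1) ↔ Q = 4 ∧ Complex.exp K = -1 := by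
  constructor
  · rintro ⟨r, q, _, h, hc, rfl⟩
    obtain rfl : q = -1 := by linear_combination -hc
    obtain ⟨hQ, hK, -⟩ := (isPottsParam_neg_one_one_iff hQ).1 h
    exact ⟨hQ, hK⟩
  · rintro ⟨rfl, hK⟩
    exact ⟨-2, -1, 1, (isPottsParam_neg_one_one_iff hQ).2 ⟨rfl, hK, rfl⟩, by norm_num, rfl⟩

end IsPottsParam

namespace IsPottsParam

variable {Q : ℕ} {K r q ρ : ℂ}

theorem bracket_eq_rhoBracket {X C : Type*} [Fintype X] [DecidableEq X] (h : IsPottsParam Q K r q ρ)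
    (D : LinkDiagram X C) :
    D.bracket (r⁻¹ * (Complex.exp K - 1)) r = D.rhoBracket q ρ := by
  rw [LinkDiagram.rhoBracket, h.site_value, h.loop_value]

theorem exists_discriminant (h : IsPottsParam Q K r q ρ) :
    ∃ w : ℂ, w ^ 2 = (Q : ℂ) - 4 ∧ q = (r + w) / 2 ∧ q⁻¹ = (r - w) / 2 := by
  have mul_inv := mul_inv_cancel₀ h.q_ne
  refine ⟨q - q⁻¹, ?_, ?_, ?_⟩
  · rw [← h.sq_root, ← h.loop_value]
    linear_combination -4 * mul_inv
  all_goals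
    rw [← h.loop_value]
    ring

theorem exists_rho (hQ : Q ≠ 0) (h : IsPottsParam Q K r q ρ) :
    ∃ u : ℂ, u ^ 2 = 1 - 4 / (Q : ℂ) ∧ ρ = (Complex.exp K - 1) * ((-1 + u) / 2) := by
  obtain ⟨w, hw, -, q_inv⟩ := h.exists_discriminant
  have hr := ne_zero_of_sq_eq_natCast hQ h.sq_root
  have hQ' : (Q : ℂ) ≠ 0 := Nat.cast_ne_zero.2 hQ
  refine ⟨w / r, ?_, ?_⟩
  · rw [div_pow, hw, h.sq_root, sub_div, div_self hQ']
  · have rho_eq : ρ = -(q⁻¹ * (r⁻¹ * (Complex.exp K - 1))) := by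
      rw [← h.site_value, mul_neg, neg_neg, inv_mul_cancel_left₀ h.q_ne]
    rw [rho_eq, q_inv]
    field_simp
    ring

theorem im_ne_zero (hQ : Q ≠ 0) (h : IsPottsParam Q K r q 1) : K.im ≠ 0 := by
  intro im_eq_zero
  obtain ⟨x, rfl⟩ : ∃ x : ℝ, K = x := ⟨K.re, Complex.ext rfl im_eq_zero⟩
  obtain ⟨hr, hq, hqr, hx⟩ := (isPottsParam_one_iff hQ).1 h
  have sq_mul_sq : r ^ 2 * q ^ 2 = (q ^ 2 + 1) ^ 2 := by
    rw [← hqr]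
    field_simp
  rw [hr, ← neg_eq_iff_eq_neg.2 hx] at sq_mul_sq
  have neg_mul_exp : (Q : ℝ) * -Real.exp x = (-Real.exp x + 1) ^ 2 := by exact_mod_cast sq_mul_sq
  have mul_exp_pos : 0 < (Q : ℝ) * Real.exp x := by positivity
  linarith [sq_nonneg (-Real.exp x + 1)]

theorem critical (hQ : Q ≠ 0) (h : IsPottsParam Q K r q ρ) (hc : -(ρ * q) = 1) (hρ : ρ = 1) :
    Q = 4 ∧ Complex.exp K = -1 ∧ r = -2 ∧ q = -1 ∧
      ∃ n : ℤ, K = (2 * (n : ℂ) + 1) * (Complex.I * (Real.pi : ℂ)) := by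
  subst hρ
  obtain rfl : q = -1 := by linear_combination -hc
  obtain ⟨hQ, hK, hr⟩ := (isPottsParam_neg_one_one_iff hQ).1 h
  refine ⟨hQ, hK, hr, rfl, ?_⟩
  rw [← Complex.exp_pi_mul_I, Complex.exp_eq_exp_iff_exists_int] at hK
  obtain ⟨n, hn⟩ := hK
  exact ⟨n, by rw [hn]; ring⟩

end IsPottsParam

theorem im_ne_zero_of_im_ofReal_div_ne_zero {J k : ℝ} {T : ℂ}
    (h : ((J : ℂ) / ((k : ℂ) * T)).im ≠ 0) : T.im ≠ 0 := by
  contrapose! h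
  obtain ⟨t, rfl⟩ : ∃ t : ℝ, T = t := ⟨T.re, Complex.ext rfl h⟩
  rw [← Complex.ofReal_mul, ← Complex.ofReal_div, Complex.ofReal_im]

namespace PlaneGraph

variable {V E : Type*} [Fintype V] [DecidableEq V] [Fintype E] [LinearOrder E]
  (G : PlaneGraph V E) (R : Type*) [CommRing R] {Q : ℕ} {K r q ρ : ℂ}

theorem potts_eq_finsum_chiRho [Nontrivial R] (hQ : Q ≠ 0) (h : IsPottsParam Q K r q ρ) :
    G.potts Q K = r ^ Fintype.card V * ∑ᶠ j : ℤ, q ^ j * G.linkDiagram.chiRho R ρ j := by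
  rw [G.potts_eq_bracket hQ K h.sq_root, h.bracket_eq_rhoBracket,
    LinkDiagram.rhoBracket_eq_finsum_chiRho R h.q_ne]

theorem potts_eq_finsum_chiHomology [IsDomain R] (hQ : Q ≠ 0) (h : IsPottsParam Q K r q 1) :
    G.potts Q K =
      r ^ Fintype.card V * ∑ᶠ j : ℤ, q ^ j * (G.linkDiagram.chiHomology R j : ℂ) := by
  simp only [G.potts_eq_finsum_chiRho R hQ h, LinkDiagram.chiRho_one G.mergesOrSplits]

end PlaneGraph

theorem mainTheorem2 {V E : Type*} [Fintype V] [DecidableEq V] [Fintype E] [LinearOrder E]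
    (G : PlaneGraph V E) (R : Type*) [CommRing R] [IsDomain R]
    (Q : ℕ) (hQ : 1 ≤ Q) (K : ℂ) :
    -- `K(G)` is an alternating planar diagram
    (G.linkDiagram.IsPlanar ∧ G.linkDiagram.IsAlternating) ∧
    -- the Khovanov complex of `K(G)` is a bigraded complex
    ((∀ i j, (G.linkDiagram.chainGroup R i j).map (G.linkDiagram.differential R) ≤
        G.linkDiagram.chainGroup R (i + 1) j) ∧
      G.linkDiagram.differential R ∘ₗ G.linkDiagram.differential R = 0) ∧
    -- the Potts partition function is a bracket, for either square root of `Q`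
    (∀ r : ℂ, r ^ 2 = (Q : ℂ) →
      G.potts Q K =
        r ^ Fintype.card V * G.linkDiagram.bracket (r⁻¹ * (Complex.exp K - 1)) r) ∧
    -- expansion of the `ρ`-bracket over enhanced states and by generalized Euler characteristics
    (∀ q ρ : ℂ, q ≠ 0 →
      G.linkDiagram.rhoBracket q ρ =
        ∑ s : G.linkDiagram.EnhancedState, (-ρ) ^ s.nB * q ^ s.jdeg ∧
      (Function.support fun j : ℤ => G.linkDiagram.chiRho R ρ j).Finite ∧
      G.linkDiagram.rhoBracket q ρ = ∑ᶠ j : ℤ, q ^ j * G.linkDiagram.chiRho R ρ j) ∧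
    -- the change of variables is always possible, and it turns the one bracket into the other
    (∀ r : ℂ, r ^ 2 = (Q : ℂ) → ∃ q ρ, IsPottsParam Q K r q ρ) ∧
    (∀ r q ρ : ℂ, IsPottsParam Q K r q ρ →
      G.linkDiagram.bracket (r⁻¹ * (Complex.exp K - 1)) r = G.linkDiagram.rhoBracket q ρ ∧
      G.potts Q K =
        r ^ Fintype.card V * ∑ᶠ j : ℤ, q ^ j * G.linkDiagram.chiRho R ρ j ∧
      (∃ w : ℂ, w ^ 2 = (Q : ℂ) - 4 ∧ q = (r + w) / 2 ∧ q⁻¹ = (r - w) / 2) ∧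
      (∃ u : ℂ, u ^ 2 = 1 - 4 / (Q : ℂ) ∧ ρ = (Complex.exp K - 1) * ((-1 + u) / 2))) ∧
    -- the coefficients are Euler characteristics of Khovanov homology exactly when `ρ = 1`
    (∀ j, G.linkDiagram.chiRho R 1 j = (G.linkDiagram.chiHomology R j : ℂ)) ∧
    (Nonempty E → ∀ ρ : ℂ,
      (∀ j, G.linkDiagram.chiRho R ρ j = (G.linkDiagram.chiHomology R j : ℂ)) ↔ ρ = 1) ∧
    (∀ r q : ℂ, IsPottsParam Q K r q 1 →
      G.potts Q K =
        r ^ Fintype.card V * ∑ᶠ j : ℤ, q ^ j * (G.linkDiagram.chiHomology R j : ℂ)) ∧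
    -- the temperatures at which `ρ = 1`
    ((∃ r q, IsPottsParam Q K r q 1) ↔
      ∃ r w : ℂ, r ^ 2 = (Q : ℂ) ∧ w ^ 2 = (Q : ℂ) - 4 ∧
        Complex.exp K = (2 - (Q : ℂ) - r * w) / 2) ∧
    (Q = 2 → ((∃ r q, IsPottsParam Q K r q 1) ↔
      Complex.exp K = Complex.I ∨ Complex.exp K = -Complex.I)) ∧
    (Q = 3 → ((∃ r q, IsPottsParam Q K r q 1) ↔
      Complex.exp K = (-1 + (Real.sqrt 3 : ℂ) * Complex.I) / 2 ∨
      Complex.exp K = (-1 - (Real.sqrt 3 : ℂ) * Complex.I) / 2)) ∧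
    (Q = 4 → ((∃ r q, IsPottsParam Q K r q 1) ↔ Complex.exp K = -1)) ∧
    (4 < Q → (∃ r q, IsPottsParam Q K r q 1) →
      ∃ x : ℝ, x < 0 ∧ Complex.exp K = (x : ℂ)) ∧
    -- in all these cases `K = J / (kT)` and the temperature `T` are not real
    ((∃ r q, IsPottsParam Q K r q 1) →
      K.im ≠ 0 ∧
      ∀ (J k : ℝ) (T : ℂ), (J = 1 ∨ J = -1) → 0 < k → K = (J : ℂ) / ((k : ℂ) * T) → T.im ≠ 0) ∧
    -- at criticality
    ((∃ r q ρ, IsPottsParam Q K r q ρ ∧ -(ρ * q) = 1 ∧ ρ = 1) ↔ Q = 4 ∧ Complex.exp K = -1) ∧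
    (∀ r q ρ : ℂ, IsPottsParam Q K r q ρ → -(ρ * q) = 1 → ρ = 1 →
      Q = 4 ∧ Complex.exp K = -1 ∧ r = -2 ∧ q = -1 ∧
        ∃ n : ℤ, K = (2 * (n : ℂ) + 1) * (Complex.I * (Real.pi : ℂ))) := by
  have hD := G.mergesOrSplits
  have hQ₀ : Q ≠ 0 := Nat.one_le_iff_ne_zero.1 hQ
  refine ⟨⟨G.isPlanar, G.isAlternating⟩,
    ⟨LinkDiagram.map_chainGroup_le hD, LinkDiagram.differential_comp_self hD⟩,
    fun _ => G.potts_eq_bracket hQ₀ K,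
    fun q ρ hq => ⟨LinkDiagram.rhoBracket_eq_sum hq ρ, LinkDiagram.finite_support_chiRho R _ ρ,
      LinkDiagram.rhoBracket_eq_finsum_chiRho R hq ρ⟩,
    fun _ => exists_isPottsParam K,
    fun _ _ _ h => ⟨h.bracket_eq_rhoBracket _, G.potts_eq_finsum_chiRho R hQ₀ h,
      h.exists_discriminant, h.exists_rho hQ₀⟩,
    LinkDiagram.chiRho_one hD, fun _ _ => G.chiRho_eq_chiHomology_iff,
    fun _ _ => G.potts_eq_finsum_chiHomology R hQ₀,
    exists_isPottsParam_one_iff hQ₀, ?_, ?_, ?_, exists_exp_eq_neg_of_isPottsParam_one, ?_,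
    exists_isPottsParam_critical_iff hQ₀, fun _ _ _ h => h.critical hQ₀⟩
  · exact fun hQ => hQ ▸ exists_isPottsParam_two_one_iff
  · exact fun hQ => hQ ▸ exists_isPottsParam_three_one_iff
  · exact fun hQ => hQ ▸ exists_isPottsParam_four_one_iff
  · rintro ⟨r, q, h⟩
    exact ⟨h.im_ne_zero hQ₀, fun J k T _ _ hK =>
      im_ne_zero_of_im_ofReal_div_ne_zero (hK ▸ h.im_ne_zero hQ₀)⟩
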